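/- Let $E$ be a complex Banach space, let $p,q\ge 1$ be integers and let $k,l>0$ be real. For $r>0$ let $D_r=\{x\in\mathbb C:|x|<r\}$ and let $\mathcal O_b(D_r,E)$ be the Banach space of bounded holomorphic maps $D_r\to E$ with the supremum norm. $E\{x_1,x_2\}$ denotes the set of formal power series in $E[[x_1,x_2]]$ that converge in some neighbourhood of the origin. *Summability in one variable.* Let $F$ be a complex Banach space. A series $\sum c_nx^n\in F[[x]]$ is $k$-summable in the direction $d$ if there are a sector $V(a,b,r)=\{0<|x|<r,\ a<\arg x<b\}$ (on the Riemann surface of the logarithm) with $b-a>\pi/k$ and $(a+b)/2=d$, and a holomorphic $f:V(a,b,r)\to F$, such that for all $a<a'<b'<b$ and $0<r'<r$ there are $C,A>0$ with $\|f(x)-\sum_{n<N}c_nx^n\|\le CA^N N!^{1/k}|x|^N$ for all $N\ge 0$ and $x\in V(a',b',r')$. It is $k$-summable if this holds for every direction $d$ with finitely many exceptions modulo $2\pi$. For $j\in\{1,2\}$, $\mathcal O_b(D_r,E)\{x_j\}_{1/k}$ is the set of $\hat f\in E[[x_1,x_2]]$ that, written as series in $x_j$, have coefficients which are (Taylor series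 at $0$ of) elements of $\mathcal O_b(D_r,E)$ in the other variable, and are $k$-summable in $x_j$, with $F=\mathcal O_b(D_r,E)$. *Summability in a monomial.* Let $\mathcal C$ be the set of $\hat f\in E[[x_1,x_2]]$ whose coefficients, as series in $x_1$ and also as series in $x_2$, all lie in $\mathcal O_b(D_r,E)$ for one $r>0$. Write $\hat f=\sum a_{n,m}x_1^nx_2^m=\sum_n f_n\,(x_1^px_2^q)^n$ with $f_n=\sum_{m<p\text{ or }j<q}a_{np+m,nq+j}x_1^mx_2^j$. Let $\Pi(a,b,r)=\{0<|x_1|^p,|x_2|^q<r,\ a<\arg(x_1^px_2^q)<b\}$, where a point carries the chosen determination of $\arg(x_1^px_2^q)$. Then $\hat f\in\mathcal C$ is $l$-summable in $x_1^px_2^q$ in the direction $d$ if there are $a<b$ and $r>0$ with $b-a>\pi/l$ and $(a+b)/2=d$, a holomorphic $f:\Pi(a,b,r)\to E$, and $0<R\le r$ such that all $f_n$ converge to bounded holomorphic maps on $D_R^2$ and, for all $a<a'<b'<b$ and $0<\rho<R$, there are $C,A>0$ with $\|f-\sum_{n<N}f_n\,(x_1^px_2^q)^n\|\le CA^N N!^{1/l}|x_1^px_2^q|^N$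 on $\Pi(a',b',\rho)\cap D_R^2$ for all $N\ge0$. The set $E\{x_1,x_2\}^{(p,q)}_{1/l}$ consists of the $\hat f\in\mathcal C$ for which this holds for every direction $d$ with finitely many exceptions modulo $2\pi$. **Theorem.** 1. For all $r,r'>0$, $\mathcal O_b(D_r,E)\{x_1\}_{1/k}\cap\mathcal O_b(D_{r'},E)\{x_2\}_{1/l}\subseteq E\{x_1,x_2\}$. Conversely, every $\hat f\in E\{x_1,x_2\}$ lies in $\mathcal O_b(D_r,E)\{x_1\}_{1/k}\cap\mathcal O_b(D_r,E)\{x_2\}_{1/l}$ for all sufficiently small $r>0$. 2. For $j=1,2$ and all $r>0$, $\mathcal O_b(D_r,E)\{x_j\}_{1/k}\cap E\{x_1,x_2\}^{(p,q)}_{1/l}\subseteq E\{x_1,x_2\}$. Conversely, every $\hat f\in E\{x_1,x_2\}$ lies in $\mathcal O_b(D_r,E)\{x_j\}_{1/k}\cap E\{x_1,x_2\}^{(p,q)}_{1/l}$ for all sufficiently small $r>0$. -/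

import Mathlib

open scoped Nat BoundedContinuousFunction

namespace MonomialSummability

/-- The open sector `V(a,b,r) = {0 < |x| < r, a < arg x < b}` of the Riemann surface of the
logarithm, in the coordinate `w = log x` (so `x = exp w`, `|x| = exp (re w)`, `arg x = im w`).
If `b - a ≤ 2π` this is the same as a sector of `ℂ`. -/
def logSector (a b r : ℝ) : Set ℂ :=
  {w | Real.exp w.re < r ∧ a < w.im ∧ w.im < b}

/-- `f ∼_s ∑ cₙ xⁿ` on `V(a,b,r)`: Gevrey asymptotic expansion of order `s`, where `f` is a function
of `w = log x`. -/
def HasGevreyExpansion {F : Type*} [NormedAddCommGroup F] [NormedSpace ℂ F]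
    (s a b r : ℝ) (f : ℂ → F) (c : ℕ → F) : Prop :=
  ∀ a' b' r' : ℝ, a < a' → a' < b' → b' < b → 0 < r' → r' < r →
    ∃ C > 0, ∃ A > 0, ∀ N : ℕ, ∀ w ∈ logSector a' b' r',
      ‖f w - ∑ n ∈ Finset.range N, (Complex.exp w) ^ n • c n‖
        ≤ C * A ^ N * (N ! : ℝ) ^ s * ‖Complex.exp w‖ ^ N

/-- The formal series `∑ cₙ xⁿ` is `k`-summable in the direction `d`. -/
def IsSummableInDirection {F : Type*} [NormedAddCommGroup F] [NormedSpace ℂ F]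
    (k : ℝ) (c : ℕ → F) (d : ℝ) : Prop :=
  ∃ a b r : ℝ, 0 < r ∧ Real.pi / k < b - a ∧ (a + b) / 2 = d ∧
    ∃ f : ℂ → F, DifferentiableOn ℂ f (logSector a b r) ∧ HasGevreyExpansion (1 / k) a b r f c

/-- The formal series `∑ cₙ xⁿ` is `k`-summable: it is so in every direction, with finitely many
exceptions modulo `2π`. -/
def IsKSummable {F : Type*} [NormedAddCommGroup F] [NormedSpace ℂ F]
    (k : ℝ) (c : ℕ → F) : Prop :=
  ∃ S : Set Real.Angle, S.Finite ∧
    ∀ d : ℝ, (d : Real.Angle) ∉ S → IsSummableInDirection k c d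

/-- `𝒪_b(D_r, E)`: bounded holomorphic maps on the disk `D_r`, with the supremum norm. -/
def Ob (r : ℝ) (E : Type*) [NormedAddCommGroup E] [NormedSpace ℂ E] :
    Submodule ℂ (Metric.ball (0 : ℂ) r →ᵇ E) where
  carrier := {g | ∃ G : ℂ → E, DifferentiableOn ℂ G (Metric.ball 0 r) ∧ ∀ x, g x = G x}
  add_mem' := by
    rintro g h ⟨G, hG, hgG⟩ ⟨H, hH, hhH⟩
    exact ⟨fun x => G x + H x, hG.add hH, fun x => by simp [hgG, hhH]⟩
  zero_mem' := ⟨fun _ => 0, differentiableOn_const _, fun _ => rfl⟩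
  smul_mem' := by
    rintro z g ⟨G, hG, hgG⟩
    exact ⟨fun x => z • G x, hG.const_smul z, fun x => by simp [hgG]⟩

/-- Formal power series `∑ a_{n,m} x₁ⁿ x₂ᵐ` in two variables with coefficients in `E`
(that is, `E[[x₁,x₂]]`), given by `n ↦ m ↦ a_{n,m}`. -/
abbrev Series₂ (E : Type*) := ℕ → ℕ → E

/-- The coefficient of the `n`-th power of the variable with index `j` (`0` for `x₁`, `1` for `x₂`),
as a formal power series in the other variable. -/
def slice {E : Type*} (j : Fin 2) (a : Series₂ E) (n : ℕ) : ℕ → E :=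
  fun m => if j = 0 then a n m else a m n

/-- `c n ∈ 𝒪_b(D_r, E)` is the sum of the `n`-th coefficient of `a` as a series in the variable
with index `j`, for all `n`. So `a`, as an element of `𝒪_b(D_r, E)[[x_j]]`, is `∑ (c n) x_jⁿ`. -/
def IsExpansionIn {E : Type*} [NormedAddCommGroup E] [NormedSpace ℂ E]
    (j : Fin 2) (r : ℝ) (a : Series₂ E) (c : ℕ → Ob r E) : Prop :=
  ∀ n : ℕ, ∀ x : Metric.ball (0 : ℂ) r, HasSum (fun m => (x : ℂ) ^ m • slice j a n m) ((c n).1 x)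

/-- `𝒪_b(D_r, E){x_j}_{1/k}`: series that are `k`-summable in the single variable with index `j`,
with coefficients in the Banach space `𝒪_b(D_r, E)`. -/
def summableInVariable (E : Type*) [NormedAddCommGroup E] [NormedSpace ℂ E]
    (j : Fin 2) (r k : ℝ) : Set (Series₂ E) :=
  {a | ∃ c : ℕ → Ob r E, IsExpansionIn j r a c ∧ IsKSummable k c}

/-- `E{x₁,x₂}`: series that converge in a neighbourhood of the origin. -/
def convergentSeries (E : Type*) [NormedAddCommGroup E] [NormedSpace ℂ E] : Set (Series₂ E) :=
  {a | ∃ r > 0, ∀ x₁ ∈ Metric.ball (0 : ℂ) r, ∀ x₂ ∈ Metric.ball (0 : ℂ) r,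
    Summable fun n : ℕ × ℕ => (x₁ ^ n.1 * x₂ ^ n.2) • a n.1 n.2}

/-- `𝒞 = ⋃_{r>0} 𝒪_b(D_r, E)[[x₁]] ∩ 𝒪_b(D_r, E)[[x₂]]`. -/
def seriesC (E : Type*) [NormedAddCommGroup E] [NormedSpace ℂ E] : Set (Series₂ E) :=
  {a | ∃ r > 0, ∀ j : Fin 2, ∃ c : ℕ → Ob r E, IsExpansionIn j r a c}

/-- The series `f_n = ∑_{m<p or j<q} a_{np+m,nq+j} x₁ᵐ x₂ʲ` in the unique decomposition
`∑ a_{n,m} x₁ⁿ x₂ᵐ = ∑ f_n (x₁ᵖ x₂^q)ⁿ`. -/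
def block {E : Type*} [Zero E] (p q : ℕ) (a : Series₂ E) (n : ℕ) : Series₂ E :=
  fun m j => if m < p ∨ j < q then a (n * p + m) (n * q + j) else 0

/-- The series `a` converges on `D_r²` to the bounded holomorphic map `g`. -/
def HasBoundedSum {E : Type*} [NormedAddCommGroup E] [NormedSpace ℂ E]
    (r : ℝ) (a : Series₂ E) (g : ℂ × ℂ → E) : Prop :=
  DifferentiableOn ℂ g (Metric.ball 0 r ×ˢ Metric.ball 0 r) ∧
  (∃ M : ℝ, ∀ x ∈ Metric.ball (0 : ℂ) r ×ˢ Metric.ball (0 : ℂ) r, ‖g x‖ ≤ M) ∧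
  ∀ x ∈ Metric.ball (0 : ℂ) r ×ˢ Metric.ball (0 : ℂ) r,
    HasSum (fun n : ℕ × ℕ => (x.1 ^ n.1 * x.2 ^ n.2) • a n.1 n.2) (g x)

/-- The sector `Π_{p,q}(a,b,r) = {0 < |x₁|ᵖ, |x₂|^q < r, a < arg (x₁ᵖ x₂^q) < b}` in the monomial
`x₁ᵖ x₂^q`. Its points are triples `(x₁, x₂, t)`, where `t` is a logarithm of `x₁ᵖ x₂^q` and `im t` is
the determination of `arg (x₁ᵖ x₂^q)`. If `b - a ≤ 2π`, then `t` is determined by `(x₁, x₂)` and this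
is the same as a subset of `ℂ²`. -/
def monomialSector (p q : ℕ) (a b r : ℝ) : Set (ℂ × ℂ × ℂ) :=
  {z | Complex.exp z.2.2 = z.1 ^ p * z.2.1 ^ q ∧ 0 < ‖z.1‖ ^ p ∧ ‖z.1‖ ^ p < r ∧
    0 < ‖z.2.1‖ ^ q ∧ ‖z.2.1‖ ^ q < r ∧ a < z.2.2.im ∧ z.2.2.im < b}

/-- The local parametrization
`(w₁, w₂) ↦ (exp w₁, exp w₂, p w₁ + q w₂ + 2πiν)` of the surface `{exp t = x₁ᵖ x₂^q, x₁ x₂ ≠ 0}`.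
It is a local biholomorphism for each integer `ν`, and every point of the surface is reached
for some `ν`. -/
noncomputable def monomialChart (p q : ℕ) (ν : ℤ) (w : ℂ × ℂ) : ℂ × ℂ × ℂ :=
  (Complex.exp w.1, Complex.exp w.2, p * w.1 + q * w.2 + 2 * Real.pi * ν * Complex.I)

/-- `f ∈ 𝒪(Π_{p,q}(a,b,r), E)`. -/
def HolomorphicOnMonomialSector {E : Type*} [NormedAddCommGroup E] [NormedSpace ℂ E]
    (p q : ℕ) (a b r : ℝ) (f : ℂ × ℂ × ℂ → E) : Prop :=
  ∀ ν : ℤ, DifferentiableOn ℂ (f ∘ monomialChart p q ν)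
    (monomialChart p q ν ⁻¹' monomialSector p q a b r)

/-- `f ∼_s^{(p,q)} â` on `Π_{p,q}(a,b,r)`: Gevrey asymptotic expansion of order `s` in the monomial
`x₁ᵖ x₂^q`. The estimates are made where the bounded holomorphic coefficients `f_n` live, that is,
on the polydisk `D_R²`. -/
def HasMonomialGevreyExpansion {E : Type*} [NormedAddCommGroup E] [NormedSpace ℂ E]
    (p q : ℕ) (s a b r : ℝ) (f : ℂ × ℂ × ℂ → E) (â : Series₂ E) : Prop :=
  ∃ R : ℝ, 0 < R ∧ R ≤ r ∧ ∃ g : ℕ → ℂ × ℂ → E,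
    (∀ n, HasBoundedSum R (block p q â n) (g n)) ∧
    ∀ a' b' ρ : ℝ, a < a' → a' < b' → b' < b → 0 < ρ → ρ < R →
      ∃ C > 0, ∃ A > 0, ∀ N : ℕ, ∀ z ∈ monomialSector p q a' b' ρ,
        ‖z.1‖ < R → ‖z.2.1‖ < R →
          ‖f z - ∑ n ∈ Finset.range N, (z.1 ^ p * z.2.1 ^ q) ^ n • g n (z.1, z.2.1)‖
            ≤ C * A ^ N * (N ! : ℝ) ^ s * ‖z.1 ^ p * z.2.1 ^ q‖ ^ N

/-- The series `â` is `k`-summable in the monomial `x₁ᵖ x₂^q` in the direction `d`. -/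
def IsMonomialSummableInDirection {E : Type*} [NormedAddCommGroup E] [NormedSpace ℂ E]
    (p q : ℕ) (k : ℝ) (â : Series₂ E) (d : ℝ) : Prop :=
  ∃ a b r : ℝ, 0 < r ∧ Real.pi / k < b - a ∧ (a + b) / 2 = d ∧
    ∃ f : ℂ × ℂ × ℂ → E, HolomorphicOnMonomialSector p q a b r f ∧
      HasMonomialGevreyExpansion p q (1 / k) a b r f â

/-- `E{x₁,x₂}^{(p,q)}_{1/k}`: series in `𝒞` that are `k`-summable in the monomial `x₁ᵖ x₂^q`, in every
direction, with finitely many exceptions modulo `2π`. -/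
def summableInMonomial (E : Type*) [NormedAddCommGroup E] [NormedSpace ℂ E]
    (p q : ℕ) (k : ℝ) : Set (Series₂ E) :=
  {a | a ∈ seriesC E ∧ ∃ S : Set Real.Angle, S.Finite ∧
    ∀ d : ℝ, (d : Real.Angle) ∉ S → IsMonomialSummableInDirection p q k a d}

end MonomialSummability

namespace MonomialSummability

/-! ### Vector-valued power series and Cauchy estimates. -/

section PowerSeries

variable {E : Type*} [NormedAddCommGroup E] [NormedSpace ℂ E]

/-! Watson's lemma (`eq_zero_of_gevrey_flat`) says that a function that is Gevrey flat of order
`1/k` on a sector of opening greater than `π/k` vanishes. Hence, wherever the coefficients of a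
summable series grow only geometrically, the series converges to the given function
(`hasSum_of_hasGevreyExpansion`).

Write the series as `∑ h m (x₁) x₂ᵐ`. By Cauchy's estimate it suffices to find bounds `‖h m‖ ≤ C Kᵐ`
on one circle around the origin. Summability in `x₁` gives such bounds on a small disk about some `z
≠ 0`, as near to the origin as desired: the `m`-th Taylor coefficient is a functional of norm at
most `r⁻ᵐ` on `𝒪_b(D_r, E)`, and Watson's lemma identifies its value on the sum with `h m`. The
second summability hypothesis then enlarges the disk by a Hartogs-type argument,
`exists_bound_of_cross`. The Taylor coefficients in `x₁` at `z` are holomorphic in `x₂` near the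
origin with a weak bound, and satisfy a strong bound near arbitrarily small points `s₀`. A
two-constants estimate turns the two into convergence on nearly the whole large disk.

If the second hypothesis is summability in `x₂`, the sum in `x₂` is already bounded and holomorphic
in `x₁` on a disk about the origin, and one application of `exists_bound_of_cross` reaches a circle
around the origin.

If it is summability in the monomial, the sectors covering all directions bound the `f_n` uniformly
near the origin (`exists_block_bound`). For a fixed `x₁` at which the series in `x₂` converges, a
Schwarz lemma compares its sum with the partial sums of `∑ f_n tⁿ`, and Watson's lemma in `t = x₁ᵖ
x₂^q` identifies it with the monomial sum. The substitution `x₂ = s (x₁/z)^(-p/q)` keeps `t`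
independent of `x₁`, so `exists_bound_of_cross` applies and spreads the bounds from a neighbourhood
of `z` to a disk of radius `‖z‖/4` (`exists_bound_of_monomial`). Because this radius depends only on
`‖z‖`, the bounds travel around the circle by connectedness.

Conversely, convergence means geometric coefficient bounds, and then the sum of the series serves as
the asymptotic function in every direction. -/

theorem hasFPowerSeriesOnBall_of_hasSum {c : ℕ → E} {G : ℂ → E} {z : ℂ} {R : ℝ} (hR : 0 < R)
    (h : ∀ x ∈ Metric.ball z R, HasSum (fun n => (x - z) ^ n • c n) (G x)) :
    HasFPowerSeriesOnBall G (fun n => ContinuousMultilinearMap.mkPiRing ℂ (Fin n) (c n)) z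
      (ENNReal.ofReal R) where
  r_le := by
    refine ENNReal.le_of_forall_nnreal_lt fun ρ hρ => ?_
    have hρR : (ρ : ℝ) < R := by
      rw [← ENNReal.ofReal_coe_nnreal] at hρ
      exact (ENNReal.ofReal_lt_ofReal_iff hR).1 hρ
    have hx : z + (ρ : ℂ) ∈ Metric.ball z R := by
      simpa [Metric.mem_ball, dist_eq_norm] using hρR
    have h1 := (h _ hx).summable.tendsto_atTop_zero.norm
    refine FormalMultilinearSeries.le_radius_of_tendsto (l := 0) _ ?_
    simpa [norm_smul, mul_comm] using h1
  r_pos := by simpa using hR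
  hasSum := by
    intro y hy
    have hy' : z + y ∈ Metric.ball z R := by
      rw [Metric.eball_ofReal] at hy
      simpa [Metric.mem_ball, dist_eq_norm] using hy
    simpa using h _ hy'

theorem differentiableOn_of_hasSum [CompleteSpace E] {c : ℕ → E} {G : ℂ → E} {z : ℂ} {R : ℝ}
    (hR : 0 < R) (h : ∀ x ∈ Metric.ball z R, HasSum (fun n => (x - z) ^ n • c n) (G x)) :
    DifferentiableOn ℂ G (Metric.ball z R) := by
  have := (hasFPowerSeriesOnBall_of_hasSum hR h).differentiableOn
  rwa [Metric.eball_ofReal] at this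

theorem iteratedDeriv_of_hasSum [CompleteSpace E] {c : ℕ → E} {G : ℂ → E} {z : ℂ} {R : ℝ}
    (hR : 0 < R) (h : ∀ x ∈ Metric.ball z R, HasSum (fun n => (x - z) ^ n • c n) (G x)) (n : ℕ) :
    iteratedDeriv n G z = n ! • c n := by
  have := (hasFPowerSeriesOnBall_of_hasSum hR h).factorial_smul 1 n
  rw [iteratedDeriv_eq_iteratedFDeriv, ← this]
  simp

/-- Cauchy's estimate for the coefficients of a power series. -/
theorem norm_coeff_le_of_hasSum [CompleteSpace E] {c : ℕ → E} {G : ℂ → E} {z : ℂ} {R ρ B : ℝ}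
    (hρ : 0 < ρ) (hρR : ρ < R)
    (h : ∀ x ∈ Metric.ball z R, HasSum (fun n => (x - z) ^ n • c n) (G x))
    (hB : ∀ x ∈ Metric.sphere z ρ, ‖G x‖ ≤ B) (n : ℕ) : ‖c n‖ ≤ B / ρ ^ n := by
  have hd : DiffContOnCl ℂ G (Metric.ball z ρ) :=
    (differentiableOn_of_hasSum (hρ.trans hρR) h).diffContOnCl_ball
      (Metric.closedBall_subset_ball hρR)
  have := Complex.norm_iteratedDeriv_le_of_forall_mem_sphere_norm_le n hρ hd hB
  rw [iteratedDeriv_of_hasSum (hρ.trans hρR) h, ← Nat.cast_smul_eq_nsmul ℂ, norm_smul,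
    Complex.norm_natCast, mul_div_assoc] at this
  exact le_of_mul_le_mul_left this (by positivity)

theorem coeff_unique_of_hasSum [CompleteSpace E] {c c' : ℕ → E} {G : ℂ → E} {z : ℂ} {R : ℝ}
    (hR : 0 < R) (h : ∀ x ∈ Metric.ball z R, HasSum (fun n => (x - z) ^ n • c n) (G x))
    (h' : ∀ x ∈ Metric.ball z R, HasSum (fun n => (x - z) ^ n • c' n) (G x)) : c = c' := by
  funext n
  have h1 := iteratedDeriv_of_hasSum hR h n
  rw [iteratedDeriv_of_hasSum hR h' n, ← Nat.cast_smul_eq_nsmul ℂ,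
    ← Nat.cast_smul_eq_nsmul ℂ] at h1
  exact (smul_right_injective E (by exact_mod_cast n.factorial_ne_zero : (n ! : ℂ) ≠ 0) h1).symm

theorem exists_hasSum_of_differentiableOn [CompleteSpace E] {G : ℂ → E} {z : ℂ} {R : ℝ}
    (h : DifferentiableOn ℂ G (Metric.ball z R)) :
    ∃ c : ℕ → E, ∀ x ∈ Metric.ball z R, HasSum (fun n => (x - z) ^ n • c n) (G x) :=
  ⟨fun n => (n ! : ℂ)⁻¹ • iteratedDeriv n G z, fun x hx => by
    simpa only [smul_smul, mul_comm] using Complex.hasSum_taylorSeries_on_ball h hx⟩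

/-- Cauchy's estimate on an open disk. -/
theorem norm_coeff_le_of_hasSum_ball [CompleteSpace E] {c : ℕ → E} {G : ℂ → E} {z : ℂ} {R B : ℝ}
    (hR : 0 < R) (h : ∀ x ∈ Metric.ball z R, HasSum (fun n => (x - z) ^ n • c n) (G x))
    (hB : ∀ x ∈ Metric.ball z R, ‖G x‖ ≤ B) (n : ℕ) : ‖c n‖ ≤ B / R ^ n := by
  have hev : ∀ᶠ ρ in nhdsWithin R (Set.Iio R), ‖c n‖ ≤ B / ρ ^ n := by
    filter_upwards [Ioo_mem_nhdsLT hR] with ρ hρ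
    exact norm_coeff_le_of_hasSum hρ.1 hρ.2 h
      (fun x hx => hB x (Metric.sphere_subset_ball hρ.2 hx)) n
  have hlim : Filter.Tendsto (fun ρ : ℝ => B / ρ ^ n) (nhdsWithin R (Set.Iio R))
      (nhds (B / R ^ n)) :=
    (((continuousAt_const.div (continuousAt_id.pow n) (by simpa using (pow_pos hR n).ne')) :
      ContinuousAt (fun ρ : ℝ => B / ρ ^ n) R).tendsto).mono_left nhdsWithin_le_nhds
  exact ge_of_tendsto hlim hev

theorem norm_le_of_hasSum_geometric {c : ℕ → E} {y : E} {x : ℂ} {B t : ℝ} (ht0 : 0 ≤ t)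
    (ht : t < 1) (h : HasSum (fun n => x ^ n • c n) y)
    (hb : ∀ n, ‖x ^ n • c n‖ ≤ B * t ^ n) : ‖y‖ ≤ B * (1 - t)⁻¹ :=
  h.norm_le_of_bounded ((hasSum_geometric_of_lt_one ht0 ht).mul_left B) hb

theorem summable_of_geometric [CompleteSpace E] {c : ℕ → E} {x : ℂ} {B t : ℝ} (ht0 : 0 ≤ t)
    (ht : t < 1) (hb : ∀ n, ‖x ^ n • c n‖ ≤ B * t ^ n) : Summable (fun n => x ^ n • c n) :=
  .of_norm_bounded ((summable_geometric_of_lt_one ht0 ht).mul_left B) hb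

end PowerSeries

/-! ### Watson's lemma and sums of convergent Gevrey expansions. -/

section Watson

theorem logSector_eq {a b r : ℝ} (hr : 0 < r) :
    logSector a b r = {w : ℂ | w.re < Real.log r} ∩ ({w | a < w.im} ∩ {w | w.im < b}) := by
  ext w
  simp [logSector, Real.lt_log_iff_exp_lt hr]

theorem isOpen_logSector (a b r : ℝ) : IsOpen (logSector a b r) :=
  (isOpen_lt (Real.continuous_exp.comp Complex.continuous_re) continuous_const).inter
    ((isOpen_lt continuous_const Complex.continuous_im).inter
      (isOpen_lt Complex.continuous_im continuous_const))

theorem convex_logSector (a b : ℝ) {r : ℝ} (hr : 0 < r) : Convex ℝ (logSector a b r) := by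
  rw [logSector_eq hr]
  exact (convex_halfSpace_re_lt _).inter
    ((convex_halfSpace_im_gt _).inter (convex_halfSpace_im_lt _))

theorem logSector_subset {a b r a' b' r' : ℝ} (ha : a ≤ a') (hb : b' ≤ b) (hr : r' ≤ r) :
    logSector a' b' r' ⊆ logSector a b r :=
  fun _ hw => ⟨hw.1.trans_le hr, ha.trans_lt hw.2.1, hw.2.2.trans_le hb⟩

/-- Optimal truncation: Gevrey flatness is exponential flatness. -/
theorem gevrey_le_exp {k A C y v : ℝ} (hk : 0 < k) (hA : 0 < A) (hC : 0 ≤ C) (hy : 0 < y)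
    (h : ∀ N : ℕ, v ≤ C * A ^ N * (N ! : ℝ) ^ (1 / k) * y ^ N) :
    v ≤ 2 * C * Real.exp (-(Real.log 2 * (2 * A * y) ^ (-k))) := by
  -- For `N = ⌊X⌋` one has `N!^(1/k) ≤ N^(N/k) ≤ (2Ay)^(-N)`, so the bound of index `N` is at most
  -- `C 2^(-N)`; passing from `N` to `X` costs the factor `2`.
  set X : ℝ := (2 * A * y) ^ (-k) with hX
  have hX0 : 0 < X := by positivity
  set N := ⌊X⌋₊ with hN
  have hNX : (N : ℝ) ≤ X := Nat.floor_le hX0.le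
  have h1 : (N : ℝ) ^ (1 / k) ≤ (2 * A * y)⁻¹ := by
    calc (N : ℝ) ^ (1 / k) ≤ X ^ (1 / k) :=
          Real.rpow_le_rpow (by positivity) hNX (by positivity)
      _ = (2 * A * y)⁻¹ := by
          rw [hX, ← Real.rpow_mul (by positivity), ← Real.rpow_neg_one]
          congr 1
          field_simp
  have h2 : (N ! : ℝ) ^ (1 / k) ≤ ((N : ℝ) ^ (1 / k)) ^ N := by
    calc (N ! : ℝ) ^ (1 / k) ≤ ((N : ℝ) ^ N) ^ (1 / k) :=
          Real.rpow_le_rpow (by positivity) (by exact_mod_cast N.factorial_le_pow) (by positivity)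
      _ = ((N : ℝ) ^ (1 / k)) ^ N := by
          rw [← Real.rpow_natCast, ← Real.rpow_natCast, ← Real.rpow_mul (by positivity),
            ← Real.rpow_mul (by positivity), mul_comm]
  have h3 : A ^ N * (N ! : ℝ) ^ (1 / k) * y ^ N ≤ (1 / 2 : ℝ) ^ N := by
    calc A ^ N * (N ! : ℝ) ^ (1 / k) * y ^ N
        ≤ A ^ N * ((2 * A * y)⁻¹) ^ N * y ^ N := by
          gcongr
          exact h2.trans (pow_le_pow_left₀ (by positivity) h1 N)
      _ = (1 / 2 : ℝ) ^ N := by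
          rw [← mul_pow, ← mul_pow]
          congr 1
          field_simp
  have h4 : (1 / 2 : ℝ) ^ N ≤ 2 * Real.exp (-(Real.log 2 * X)) := by
    have h5 : X < N + 1 := Nat.lt_floor_add_one X
    have h6 : (1 / 2 : ℝ) ^ N = Real.exp (-(Real.log 2 * N)) := by
      rw [← neg_mul, ← Real.log_inv, Real.exp_mul, Real.exp_log (by norm_num), one_div,
        Real.rpow_natCast]
    have h7 : 2 * Real.exp (-(Real.log 2 * X)) = Real.exp (Real.log 2 + -(Real.log 2 * X)) := by
      rw [Real.exp_add, Real.exp_log (by norm_num)]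
    rw [h6, h7]
    have : 0 < Real.log 2 := Real.log_pos (by norm_num)
    exact Real.exp_le_exp.2 (by nlinarith)
  calc v ≤ C * (A ^ N * (N ! : ℝ) ^ (1 / k) * y ^ N) := by
        simpa only [mul_assoc] using h N
    _ ≤ C * (2 * Real.exp (-(Real.log 2 * X))) := mul_le_mul_of_nonneg_left (h3.trans h4) hC
    _ = _ := by ring

/-- Since `β > 1`, the exponent `c x^β` eventually exceeds `(n + 1) x` for every `n`. This is the
decay hypothesis of the Phragmén–Lindelöf theorem used for Watson's lemma. -/
theorem superpolynomialDecay_exp_of_le {g : ℝ → ℝ} {C c β R : ℝ} (hc : 0 < c)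
    (hβ : 1 < β) (hR : 0 ≤ R) (hg : ∀ x, 0 ≤ g x)
    (h : ∀ x, 0 ≤ x → g x ≤ C * Real.exp (-(c * (x + R) ^ β))) :
    Asymptotics.SuperpolynomialDecay Filter.atTop Real.exp g := by
  intro n
  have hC : 0 ≤ C := by
    have := (hg 0).trans (h 0 le_rfl)
    exact nonneg_of_mul_nonneg_left this (Real.exp_pos _)
  have hlim : Filter.Tendsto (fun x : ℝ => C * Real.exp (-x)) Filter.atTop (nhds 0) := by
    simpa using Real.tendsto_exp_neg_atTop_nhds_zero.const_mul C
  refine squeeze_zero' (.of_forall fun x => mul_nonneg (by positivity) (hg x)) ?_ hlim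
  have hev := (tendsto_rpow_atTop (show 0 < β - 1 by linarith)).eventually_ge_atTop ((n + 1) / c)
  filter_upwards [hev, Filter.eventually_gt_atTop 0] with x hx hx0
  have h1 : (n + 1) * x ≤ c * (x + R) ^ β := by
    have h2 : x ^ β ≤ (x + R) ^ β := Real.rpow_le_rpow hx0.le (by linarith) (by linarith)
    have h3 : x ^ β = x ^ (β - 1) * x := by
      rw [← Real.rpow_add_one hx0.ne']; congr 1; ring
    have h4 : (n + 1) ≤ x ^ (β - 1) * c := (div_le_iff₀ hc).1 hx
    calc (n + 1) * x ≤ x ^ (β - 1) * c * x := by gcongr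
      _ = c * x ^ β := by rw [h3]; ring
      _ ≤ _ := by gcongr
  calc Real.exp x ^ n * g x ≤ Real.exp x ^ n * (C * Real.exp (-(c * (x + R) ^ β))) := by
        gcongr; exact h x hx0.le
    _ = C * Real.exp (n * x - c * (x + R) ^ β) := by
        rw [← Real.exp_nat_mul, sub_eq_add_neg, Real.exp_add]; ring
    _ ≤ C * Real.exp (-x) := by gcongr; linarith

variable {E : Type*} [NormedAddCommGroup E] [NormedSpace ℂ E]

/-- **Watson's lemma**. -/
theorem eq_zero_of_gevrey_flat [CompleteSpace E] {f : ℂ → E} {k a b r C A : ℝ} (hk : 0 < k)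
    (hr : 0 < r) (hab : Real.pi / k < b - a) (hf : DifferentiableOn ℂ f (logSector a b r))
    (hC : 0 ≤ C) (hA : 0 < A)
    (hb : ∀ N : ℕ, ∀ w ∈ logSector a b r,
      ‖f w‖ ≤ C * A ^ N * (N ! : ℝ) ^ (1 / k) * ‖Complex.exp w‖ ^ N) :
    ∀ w ∈ logSector a b r, f w = 0 := by
  have hπ := Real.pi_pos
  have hba : 0 < b - a := lt_trans (by positivity) hab
  set κ := Real.pi / (b - a) with hκ
  have hκ0 : 0 < κ := by positivity
  have hκk : κ < k := by
    rw [hκ, div_lt_iff₀ hba]; rw [div_lt_iff₀ hk] at hab; linarith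
  set d := (a + b) / 2 with hd
  -- The map `W` sends `re z ≥ 0` into the sector: `arg (z + R)` lies in `(-π/2, π/2)` and is
  -- rescaled to the opening `b - a`, while `R > r^(-κ)` forces `exp (re (W z)) < r`. As `‖exp (W
  -- z)‖ = ‖z + R‖^(-1/κ)`, flatness becomes decay like `exp (-c ‖z + R‖^(k/κ))` with `k/κ > 1`.
  set R := Real.exp (-κ * Real.log r) + 1 with hRdef
  have hR0 : 0 < R := by positivity
  let W : ℂ → ℂ := fun z => -Complex.log (z + R) / κ + d * Complex.I
  have hWre : ∀ z, (W z).re = -Real.log ‖z + R‖ / κ := fun z => by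
    simp [W, Complex.log_re]
  have hWim : ∀ z, (W z).im = -Complex.arg (z + R) / κ + d := fun z => by
    simp [W, Complex.log_im]
  have hre : ∀ z : ℂ, 0 ≤ z.re → R ≤ ‖z + R‖ := fun z hz => by
    have := Complex.re_le_norm (z + R)
    simp at this
    linarith
  have hmaps : Set.MapsTo W {z | 0 ≤ z.re} (logSector a b r) := by
    intro z hz
    have hz' : 0 ≤ z.re := hz
    have hRz := hre z hz'
    rw [logSector_eq hr]
    refine ⟨?_, ?_⟩
    · change (W z).re < _
      rw [hWre, div_lt_iff₀ hκ0]
      have : -κ * Real.log r < Real.log ‖z + R‖ := by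
        rw [Real.lt_log_iff_exp_lt (hR0.trans_le hRz)]
        linarith
      linarith
    · have harg : |Complex.arg (z + R)| < Real.pi / 2 := by
        rw [Complex.abs_arg_lt_pi_div_two_iff]
        left; simp; linarith
      have h2 : Real.pi / 2 / κ = (b - a) / 2 := by rw [hκ]; field_simp
      have h3 : |-Complex.arg (z + R) / κ| < (b - a) / 2 := by
        rw [abs_div, abs_neg, abs_of_pos hκ0, ← h2]
        gcongr
      rw [abs_lt] at h3
      constructor
      · change a < (W z).im
        rw [hWim]; linarith [h3.1]
      · change (W z).im < b
        rw [hWim]; linarith [h3.2]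
  have hWd : DifferentiableOn ℂ W {z | 0 ≤ z.re} := by
    intro z hz
    have hz' : 0 ≤ z.re := hz
    have : z + R ∈ Complex.slitPlane := by
      left; simp; linarith
    exact ((((differentiableAt_id.add_const _).clog this).neg.div_const _).add_const _
      ).differentiableWithinAt
  have hFd : DifferentiableOn ℂ (f ∘ W) {z | 0 ≤ z.re} := hf.comp hWd hmaps
  set c := Real.log 2 * (2 * A) ^ (-k) with hc
  have hc0 : 0 < c := mul_pos (Real.log_pos (by norm_num)) (by positivity)
  have hbound : ∀ z : ℂ, 0 ≤ z.re →
      ‖f (W z)‖ ≤ 2 * C * Real.exp (-(c * ‖z + R‖ ^ (k / κ))) := by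
    intro z hz
    have hpos : 0 < ‖z + R‖ := hR0.trans_le (hre z hz)
    have h1 := gevrey_le_exp hk hA hC (norm_pos_iff.2 (Complex.exp_ne_zero (W z)))
      fun N => hb N (W z) (hmaps hz)
    have h2 : (2 * A * ‖Complex.exp (W z)‖) ^ (-k) = (2 * A) ^ (-k) * ‖z + R‖ ^ (k / κ) := by
      rw [Real.mul_rpow (by positivity) (by positivity), Complex.norm_exp, hWre,
        ← Real.exp_mul, Real.rpow_def_of_pos hpos]
      congr 2; field_simp
    rwa [h2, ← mul_assoc] at h1
  have hcl : closure {z : ℂ | 0 < z.re} = {z | 0 ≤ z.re} := Complex.closure_setOfPred_lt_re 0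
  have hbdd : ∀ z : ℂ, 0 ≤ z.re → ‖f (W z)‖ ≤ 2 * C := fun z hz =>
    (hbound z hz).trans (mul_le_of_le_one_right (by positivity)
      (Real.exp_le_one_iff.2 (by simp only [neg_nonpos]; positivity)))
  have hzero : Set.EqOn (f ∘ W) 0 {z | 0 ≤ z.re} := by
    refine PhragmenLindelof.eq_zero_on_right_half_plane_of_superexponential_decay
      (DifferentiableOn.diffContOnCl (by rwa [hcl])) ⟨1, by norm_num, 0, ?_⟩ ?_
      ⟨2 * C, fun x => hbdd _ (by simp)⟩
    · refine Asymptotics.IsBigO.of_bound (2 * C) ?_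
      filter_upwards [Filter.mem_inf_of_right (Filter.mem_principal_self _)] with z hz
      simpa using hbdd z (le_of_lt hz)
    · refine superpolynomialDecay_exp_of_le (C := 2 * C) (β := k / κ) (R := R) hc0
        ((one_lt_div hκ0).2 hκk) hR0.le (fun x => norm_nonneg _) fun x hx => ?_
      have := hbound x (by simpa using hx)
      rwa [← Complex.ofReal_add, Complex.norm_of_nonneg (by positivity)] at this
  have h1mem : (1 : ℂ) ∈ {z : ℂ | 0 ≤ z.re} := by simp
  -- So far `f` vanishes on the image of `W` only. The local inverse `Z` shows that this image is a
  -- neighbourhood of `W 1`, and the identity theorem does the rest.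
  have hev : f =ᶠ[nhds (W 1)] 0 := by
    let Z : ℂ → ℂ := fun w => Complex.exp (-κ * (w - d * Complex.I)) - R
    have hZW : -κ * (W 1 - d * Complex.I) = Complex.log (1 + R) := by
      have : (κ : ℂ) ≠ 0 := by exact_mod_cast hκ0.ne'
      simp only [W]; field_simp; ring
    have hR1 : (1 + R : ℂ) = ((1 + R : ℝ) : ℂ) := by push_cast; rfl
    have hZ1 : Z (W 1) = 1 := by
      simp only [Z]
      rw [hZW, Complex.exp_log (by rw [hR1]; exact_mod_cast (by positivity : (1 + R) ≠ 0))]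
      ring
    have him1 : (-κ * (W 1 - d * Complex.I) : ℂ).im = 0 := by
      rw [hZW, Complex.log_im, hR1, Complex.arg_ofReal_of_nonneg (by positivity)]
    have hZc : Continuous Z := by fun_prop
    have e1 : ∀ᶠ w in nhds (W 1), 0 < (Z w).re :=
      (Complex.continuous_re.comp hZc).continuousAt.eventually_const_lt
        (by simp [Function.comp, hZ1])
    have him : Continuous fun w : ℂ => (-κ * (w - d * Complex.I) : ℂ).im := by fun_prop
    have e2 : ∀ᶠ w in nhds (W 1), -Real.pi < (-κ * (w - d * Complex.I) : ℂ).im :=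
      him.continuousAt.eventually_const_lt (by simp only [him1]; linarith)
    have e3 : ∀ᶠ w in nhds (W 1), (-κ * (w - d * Complex.I) : ℂ).im < Real.pi :=
      him.continuousAt.eventually_lt_const (by simp only [him1]; linarith)
    filter_upwards [e1, e2, e3] with w h1 h2 h3
    have : W (Z w) = w := by
      have hκ' : (κ : ℂ) ≠ 0 := by exact_mod_cast hκ0.ne'
      simp only [W, Z, sub_add_cancel]
      rw [Complex.log_exp h2 h3.le]
      field_simp; ring
    have := hzero (le_of_lt h1 : Z w ∈ {z : ℂ | 0 ≤ z.re})
    simpa [Function.comp, ‹W (Z w) = w›] using this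
  exact (hf.analyticOnNhd (isOpen_logSector a b r)).eqOn_zero_of_preconnected_of_eventuallyEq_zero
    (convex_logSector a b hr).isPreconnected (hmaps h1mem) hev

theorem one_le_factorial_rpow (N : ℕ) {s : ℝ} (hs : 0 ≤ s) : 1 ≤ (N ! : ℝ) ^ s :=
  Real.one_le_rpow (by exact_mod_cast N.factorial_pos) hs

theorem norm_sub_sum_range_le {c : ℕ → E} {y : E} {x : ℂ} {C B t : ℝ}
    (hB : 0 ≤ B) (hc : ∀ n, ‖c n‖ ≤ C * B ^ n) (hxt : ‖x‖ * B ≤ t) (ht : t < 1)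
    (h : HasSum (fun n => x ^ n • c n) y) (N : ℕ) :
    ‖y - ∑ n ∈ Finset.range N, x ^ n • c n‖ ≤ C * (1 - t)⁻¹ * B ^ N * ‖x‖ ^ N := by
  have ht0 : 0 ≤ t := le_trans (by positivity) hxt
  have hC : 0 ≤ C := (norm_nonneg _).trans (by simpa using hc 0)
  have h1 := (hasSum_nat_add_iff' N).2 h
  have h2 := (hasSum_geometric_of_lt_one ht0 ht).mul_left (C * B ^ N * ‖x‖ ^ N)
  refine (h1.norm_le_of_bounded h2 fun n => ?_).trans_eq (by ring)
  rw [norm_smul, norm_pow]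
  calc ‖x‖ ^ (n + N) * ‖c (n + N)‖ ≤ ‖x‖ ^ (n + N) * (C * B ^ (n + N)) := by gcongr; exact hc _
    _ = C * B ^ N * ‖x‖ ^ N * (‖x‖ * B) ^ n := by ring
    _ ≤ _ := by gcongr

theorem summable_pow_smul [CompleteSpace E] {c : ℕ → E} {x : ℂ} {C B : ℝ}
    (hB : 0 ≤ B) (hc : ∀ n, ‖c n‖ ≤ C * B ^ n) (hx : ‖x‖ * B < 1) :
    Summable (fun n => x ^ n • c n) :=
  summable_of_geometric (B := C) (by positivity) hx fun n => by
    rw [norm_smul, norm_pow]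
    calc ‖x‖ ^ n * ‖c n‖ ≤ ‖x‖ ^ n * (C * B ^ n) := by gcongr; exact hc n
      _ = _ := by ring

theorem differentiableOn_tsum_exp [CompleteSpace E] {c : ℕ → E} {a b r C B : ℝ}
    (hB : 0 ≤ B) (hc : ∀ n, ‖c n‖ ≤ C * B ^ n) (hr0 : 0 ≤ r) (hr : r * B < 1) :
    DifferentiableOn ℂ (fun w => ∑' n, Complex.exp w ^ n • c n) (logSector a b r) := by
  have hC : 0 ≤ C := (norm_nonneg _).trans (by simpa using hc 0)
  refine Complex.differentiableOn_tsum_of_summable_norm (u := fun n => C * (r * B) ^ n)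
    ((summable_geometric_of_lt_one (by positivity) hr).mul_left C) (fun n => ?_)
    (isOpen_logSector a b r) fun n w hw => ?_
  · exact ((Complex.differentiable_exp.pow n).smul_const _).differentiableOn
  · rw [norm_smul, norm_pow, Complex.norm_exp]
    calc Real.exp w.re ^ n * ‖c n‖ ≤ r ^ n * (C * B ^ n) := by
          gcongr
          · exact hw.1.le
          · exact hc n
      _ = _ := by ring

/-- A function with a Gevrey expansion of convergent type on a wide sector is the sum of it. -/
theorem hasSum_of_hasGevreyExpansion [CompleteSpace E] {f : ℂ → E} {c : ℕ → E}
    {k a b r C₀ B : ℝ} (hk : 0 < k) (hab : Real.pi / k < b - a)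
    (hf : DifferentiableOn ℂ f (logSector a b r)) (hG : HasGevreyExpansion (1 / k) a b r f c)
    (hB : 0 < B) (hc : ∀ n, ‖c n‖ ≤ C₀ * B ^ n) {w : ℂ} (hw : w ∈ logSector a b r)
    (hwB : ‖Complex.exp w‖ * B < 1) : HasSum (fun n => Complex.exp w ^ n • c n) (f w) := by
  have hC₀ : 0 ≤ C₀ := (norm_nonneg _).trans (by simpa using hc 0)
  obtain ⟨hw1, hw2, hw3⟩ := hw
  -- A third of the slack: the sector shrunk by `ε` on both sides still has opening greater than
  -- `π/k` and still contains `w`.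
  set ε := min (b - a - Real.pi / k) (min (w.im - a) (b - w.im)) / 3 with hε
  have hm1 := min_le_left (b - a - Real.pi / k) (min (w.im - a) (b - w.im))
  have hm2 := (min_le_right (b - a - Real.pi / k) (min (w.im - a) (b - w.im))).trans
    (min_le_left _ _)
  have hm3 := (min_le_right (b - a - Real.pi / k) (min (w.im - a) (b - w.im))).trans
    (min_le_right _ _)
  have hε0 : 0 < ε := by
    rw [hε]
    exact div_pos (lt_min (by linarith) (lt_min (by linarith) (by linarith))) (by norm_num)
  have hπk : 0 < Real.pi / k := div_pos Real.pi_pos hk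
  rw [Complex.norm_exp, ← lt_div_iff₀ hB] at hwB
  obtain ⟨r', hr'1, hr'2⟩ := exists_between (lt_min hw1 hwB)
  have hr'0 : 0 < r' := (Real.exp_pos _).trans hr'1
  have hr'B : r' * B < 1 := (lt_div_iff₀ hB).1 (hr'2.trans_le (min_le_right _ _))
  obtain ⟨C, hC, A, hA, hCA⟩ := hG (a + ε) (b - ε) r' (by linarith) (by linarith) (by linarith)
    hr'0 (hr'2.trans_le (min_le_left _ _))
  have hsum : ∀ v ∈ logSector (a + ε) (b - ε) r', ‖Complex.exp v‖ * B ≤ r' * B := fun v hv => by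
    rw [Complex.norm_exp]; gcongr; exact hv.1.le
  -- Both `f` and the convergent sum have the same expansion, the latter with geometric remainders,
  -- which are Gevrey because `N!^(1/k) ≥ 1`. So the difference is flat.
  have hz := eq_zero_of_gevrey_flat (f := fun v => f v - ∑' n, Complex.exp v ^ n • c n)
    (C := C + C₀ * (1 - r' * B)⁻¹) (A := max A B) hk hr'0
    (a := a + ε) (b := b - ε) (by linarith)
    ((hf.mono (logSector_subset (by linarith) (by linarith)
      (hr'2.trans_le (min_le_left _ _)).le)).sub (differentiableOn_tsum_exp hB.le hc hr'0.le hr'B))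
    (add_nonneg hC.le (mul_nonneg hC₀ (inv_nonneg.2 (by linarith)))) (lt_max_of_lt_left hA)
    fun N v hv => by
      have h1 := hCA N v hv
      have h2 := norm_sub_sum_range_le hB.le hc (hsum v hv) hr'B
        (summable_pow_smul hB.le hc ((hsum v hv).trans_lt hr'B)).hasSum N
      have h3 := one_le_factorial_rpow N (one_div_nonneg.2 hk.le)
      have hinv : 0 ≤ (1 - r' * B)⁻¹ := inv_nonneg.2 (by linarith)
      set x := Complex.exp v
      calc ‖f v - ∑' n, x ^ n • c n‖
          = ‖(f v - ∑ n ∈ Finset.range N, x ^ n • c n)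
              - (∑' n, x ^ n • c n - ∑ n ∈ Finset.range N, x ^ n • c n)‖ := by
            congr 1; abel
        _ ≤ C * A ^ N * (N ! : ℝ) ^ (1 / k) * ‖x‖ ^ N
            + C₀ * (1 - r' * B)⁻¹ * B ^ N * 1 * ‖x‖ ^ N := by
            rw [mul_one]
            exact (norm_sub_le _ _).trans (add_le_add h1 h2)
        _ ≤ C * (max A B) ^ N * (N ! : ℝ) ^ (1 / k) * ‖x‖ ^ N
            + C₀ * (1 - r' * B)⁻¹ * (max A B) ^ N * (N ! : ℝ) ^ (1 / k) * ‖x‖ ^ N := by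
            gcongr
            · exact le_max_left _ _
            · exact le_max_right _ _
        _ = _ := by ring
  have hw' : w ∈ logSector (a + ε) (b - ε) r' := ⟨hr'1, by linarith, by linarith⟩
  have := hz w hw'
  rw [sub_eq_zero] at this
  rw [this]
  exact (summable_pow_smul hB.le hc ((hsum w hw').trans_lt hr'B)).hasSum

end Watson

/-! ### Enlarging the domain of convergence by a two-constants estimate. -/

section Cross

variable {E : Type*} [NormedAddCommGroup E] [NormedSpace ℂ E]

/-- Interchange of summations in an absolutely convergent double power series. -/
theorem hasSum_interchange [CompleteSpace E] {η : ℕ → ℕ → E} {y : ℕ → E} {S : E} {s x : ℂ}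
    {C K σ : ℝ} (hK : 0 ≤ K) (hσ : 0 < σ) (hη : ∀ m i, ‖η m i‖ ≤ C * K ^ m / σ ^ i)
    (hs : ‖s‖ * K < 1) (hx : ‖x‖ < σ) (hy : ∀ m, HasSum (fun i => x ^ i • η m i) (y m))
    (hS : HasSum (fun m => s ^ m • y m) S) :
    HasSum (fun i => x ^ i • ∑' m, s ^ m • η m i) S := by
  have hC : 0 ≤ C := (norm_nonneg _).trans (by simpa using hη 0 0)
  have hs' : ∀ i, Summable fun m => s ^ m • η m i := fun i =>
    summable_pow_smul (C := C / σ ^ i) hK (fun m => (hη m i).trans_eq (by ring)) hs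
  have hT : Summable fun P : ℕ × ℕ => s ^ P.1 • x ^ P.2 • η P.1 P.2 := by
    refine .of_norm_bounded (g := fun P : ℕ × ℕ => (‖s‖ * K) ^ P.1 * (C * (‖x‖ / σ) ^ P.2))
      ((summable_geometric_of_lt_one (by positivity) hs).mul_of_nonneg
        ((summable_geometric_of_lt_one (by positivity) ((div_lt_one hσ).2 hx)).mul_left C)
        (fun _ => by positivity) (fun _ => by positivity)) fun P => ?_
    rw [norm_smul, norm_smul, norm_pow, norm_pow]
    calc ‖s‖ ^ P.1 * (‖x‖ ^ P.2 * ‖η P.1 P.2‖)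
        ≤ ‖s‖ ^ P.1 * (‖x‖ ^ P.2 * (C * K ^ P.1 / σ ^ P.2)) := by gcongr; exact hη _ _
      _ = _ := by rw [div_pow, mul_pow]; ring
  have h1 : HasSum (fun m => s ^ m • y m) (∑' P : ℕ × ℕ, s ^ P.1 • x ^ P.2 • η P.1 P.2) :=
    hT.hasSum.prod_fiberwise fun m => (hy m).const_smul _
  have h2 : HasSum (fun P : ℕ × ℕ => s ^ P.2 • x ^ P.1 • η P.2 P.1)
      (∑' P : ℕ × ℕ, s ^ P.1 • x ^ P.2 • η P.1 P.2) :=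
    (Equiv.hasSum_iff (Equiv.prodComm ℕ ℕ)
      (f := fun P : ℕ × ℕ => s ^ P.1 • x ^ P.2 • η P.1 P.2)).2 hT.hasSum
  rw [hS.unique h1]
  refine h2.prod_fiberwise fun i => ?_
  have h3 := (hs' i).hasSum.const_smul (x ^ i)
  have h4 : (fun m => s ^ m • x ^ i • η m i) = fun m => x ^ i • s ^ m • η m i :=
    funext fun m => smul_comm _ _ _
  exact h4 ▸ h3

/-- Geometric mean of the two bounds with weights `L/(L+1)` and `1/(L+1)`; raising to the power `L +
1` avoids fractional exponents. -/
theorem le_of_geometric_mean {v M X Y Z : ℝ} {L : ℕ} (hv : 0 ≤ v) (hM : 0 ≤ M) (hX : 0 < X)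
    (hY : 0 < Y) (hZ : 0 < Z) (hZXY : Z ^ (L + 1) ≤ X ^ L * Y) (h1 : v ≤ M / X)
    (h2 : v ≤ M / Y) : v ≤ M / Z := by
  refine (pow_le_pow_iff_left₀ hv (by positivity) L.succ_ne_zero).1 ?_
  calc v ^ (L + 1) = v ^ L * v := pow_succ _ _
    _ ≤ (M / X) ^ L * (M / Y) := by gcongr
    _ = M ^ (L + 1) / (X ^ L * Y) := by rw [div_pow, pow_succ]; field_simp
    _ ≤ M ^ (L + 1) / Z ^ (L + 1) := by gcongr
    _ = (M / Z) ^ (L + 1) := by rw [div_pow]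

/-- A two-constants estimate for a function bounded on a disk centred at the origin and, more
strongly, on a small disk close to the origin: the coefficients at the origin profit. -/
theorem norm_coeff_le_two_disks [CompleteSpace E] {c : ℕ → E} {G : ℂ → E} {s₀ : ℂ}
    {v κ M X Y Z : ℝ} {L : ℕ} (hκ : 0 < κ) (hκ1 : κ ≤ 1) (hs₀ : 0 < ‖s₀‖) (hs₀v : 2 * ‖s₀‖ < v)
    (hs₀L : 4 ^ (L + 1) * ‖s₀‖ ≤ κ ^ L * v) (hX : 0 < X)
    (hY : 0 < Y) (hZ : 0 < Z) (hZXY : Z ^ (L + 1) ≤ X ^ L * Y)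
    (h : ∀ s ∈ Metric.ball (0 : ℂ) (2 * v), HasSum (fun m => s ^ m • c m) (G s))
    (h1 : ∀ s ∈ Metric.ball s₀ (κ * ‖s₀‖), ‖G s‖ ≤ M / X)
    (h2 : ∀ s ∈ Metric.ball (0 : ℂ) (2 * v), ‖G s‖ ≤ M / Y) (m : ℕ) :
    ‖c m‖ ≤ 2 * M / Z / ‖s₀‖ ^ m := by
  have hv : 0 < v := by linarith
  have h0mem : (0 : ℂ) ∈ Metric.ball (0 : ℂ) (2 * v) := Metric.mem_ball_self (by positivity)
  have hM : 0 ≤ M := by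
    have := (norm_nonneg _).trans (h2 0 h0mem)
    by_contra hM
    exact absurd this (not_le.2 (div_neg_of_neg_of_pos (not_le.1 hM) hY))
  have h' : ∀ s ∈ Metric.ball (0 : ℂ) (2 * v), HasSum (fun m => (s - 0) ^ m • c m) (G s) :=
    fun s hs => by simpa using h s hs
  have hsub : Metric.ball s₀ v ⊆ Metric.ball (0 : ℂ) (2 * v) :=
    Metric.ball_subset_ball' (by rw [dist_zero_right]; linarith)
  have hsub2 : Metric.ball s₀ (κ * ‖s₀‖) ⊆ Metric.ball s₀ v :=
    Metric.ball_subset_ball (by nlinarith)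
  obtain ⟨e, he⟩ := exists_hasSum_of_differentiableOn
    ((differentiableOn_of_hasSum (by positivity) h').mono hsub)
  -- The Cauchy estimates at `s₀` with radii `κ‖s₀‖` and `v` are averaged. The smallness of `s₀`
  -- gives `(4‖s₀‖)^(L+1) ≤ (κ‖s₀‖)^L v`, so the averaged radius is large enough for the expansion
  -- at `s₀` to cover the circle `‖s‖ = ‖s₀‖` with ratio `1/2`.
  have hej : ∀ j, ‖e j‖ ≤ M / (Z * (4 * ‖s₀‖) ^ j) := fun j => by
    have b1 := norm_coeff_le_of_hasSum_ball (by positivity) (fun s hs => he s (hsub2 hs)) h1 j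
    have b2 := norm_coeff_le_of_hasSum_ball hv he (fun s hs => h2 s (hsub hs)) j
    rw [div_div] at b1 b2
    refine le_of_geometric_mean (L := L) (norm_nonneg _) hM (by positivity) (by positivity)
      (by positivity) ?_ b1 b2
    calc (Z * (4 * ‖s₀‖) ^ j) ^ (L + 1) = Z ^ (L + 1) * (‖s₀‖ ^ L * (4 ^ (L + 1) * ‖s₀‖)) ^ j := by
          rw [mul_pow, ← pow_mul, mul_comm j, pow_mul]; congr 2; ring
      _ ≤ X ^ L * Y * (‖s₀‖ ^ L * (κ ^ L * v)) ^ j := by gcongr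
      _ = _ := by rw [mul_pow X, ← pow_mul (κ * _), mul_comm j, pow_mul]; ring
  have hsph : ∀ s ∈ Metric.sphere (0 : ℂ) ‖s₀‖, ‖G s‖ ≤ 2 * M / Z := fun s hs => by
    rw [mem_sphere_zero_iff_norm] at hs
    have hss : ‖s - s₀‖ ≤ 2 * ‖s₀‖ := (norm_sub_le _ _).trans (by rw [hs]; linarith)
    have := norm_le_of_hasSum_geometric (B := M / Z) (t := 1 / 2) (by norm_num) (by norm_num)
      (he s (by rw [Metric.mem_ball, dist_eq_norm]; linarith)) fun j => by
        rw [norm_smul, norm_pow]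
        calc ‖s - s₀‖ ^ j * ‖e j‖ ≤ (2 * ‖s₀‖) ^ j * (M / (Z * (4 * ‖s₀‖) ^ j)) := by
              gcongr; exact hej j
          _ = M / Z * (1 / 2) ^ j := by
              rw [show 4 * ‖s₀‖ = 2 * (2 * ‖s₀‖) by ring, mul_pow 2 (2 * ‖s₀‖), div_pow, one_pow]
              field_simp
    exact this.trans_eq (by ring)
  exact norm_coeff_le_of_hasSum hs₀ (by linarith) h' hsph m

/-- Let `∑ h m x * s ^ m` converge for `x` in a small disk, and let its sum extend, for some
arbitrarily small `s₀` and for `s` close to `s₀`, to a bounded holomorphic function of `x` in a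
larger concentric disk. Then the series converges on the larger disk. -/
theorem exists_bound_of_cross [CompleteSpace E] {h : ℕ → ℂ → E} {z : ℂ} {u σ C K κ : ℝ}
    (hσ : 0 < σ) (hσu : σ ≤ u) (hK : 0 < K) (hκ : 0 < κ) (hκ1 : κ ≤ 1)
    (hh : ∀ m, DifferentiableOn ℂ (h m) (Metric.ball z u))
    (hb : ∀ m, ∀ x ∈ Metric.ball z σ, ‖h m x‖ ≤ C * K ^ m)
    (hg : ∀ ε > 0, ∃ s₀ : ℂ, 0 < ‖s₀‖ ∧ ‖s₀‖ < ε ∧ ∃ M : ℝ, ∃ g : ℂ → ℂ → E,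
      ∀ s ∈ Metric.ball s₀ (κ * ‖s₀‖), DifferentiableOn ℂ (fun x => g x s) (Metric.ball z u) ∧
        (∀ x ∈ Metric.ball z u, ‖g x s‖ ≤ M) ∧
        ∀ x ∈ Metric.ball z σ, HasSum (fun m => s ^ m • h m x) (g x s))
    {u' : ℝ} (hu' : u' < u) :
    ∃ C' : ℝ, ∃ K' > 0, ∀ m, ∀ x ∈ Metric.ball z u', ‖h m x‖ ≤ C' * K' ^ m := by
  have hu : 0 < u := hσ.trans_le hσu
  have hC : 0 ≤ C := (norm_nonneg _).trans (by simpa using hb 0 z (Metric.mem_ball_self hσ))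
  choose η hη using fun m => exists_hasSum_of_differentiableOn (hh m)
  have hsubσ : Metric.ball z σ ⊆ Metric.ball z u := Metric.ball_subset_ball hσu
  have hηb : ∀ m i, ‖η m i‖ ≤ C * K ^ m / σ ^ i := fun m i =>
    norm_coeff_le_of_hasSum_ball hσ (fun x hx => hη m x (hsubσ hx)) (hb m) i
  obtain ⟨u₂, hu₂, hu₂u⟩ := exists_between (max_lt hu' hu)
  have hu₂0 : 0 < u₂ := (le_max_right _ _).trans_lt hu₂
  -- The weight `L` depends only on the radii and is fixed before `s₀`, so `s₀` can be taken small
  -- in terms of `L`. The bound `M` is then free to depend on `s₀`.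
  obtain ⟨L, hL⟩ := exists_pow_lt_of_lt_one (div_pos hσ hu) ((div_lt_one hu).2 hu₂u)
  have hL' : u₂ ^ (L + 1) ≤ u ^ L * σ := by
    rw [div_pow, div_lt_div_iff₀ (by positivity) hu] at hL
    calc u₂ ^ (L + 1) = u₂ ^ L * u₂ := pow_succ _ _
      _ ≤ u₂ ^ L * u := by gcongr
      _ ≤ _ := by linarith
  set v := 1 / (4 * K) with hv
  have hv0 : 0 < v := by positivity
  have hvK : 2 * v * K = 1 / 2 := by rw [hv]; field_simp; norm_num
  obtain ⟨s₀, hs₀, hs₀ε, M, g, hgs⟩ := hg (min (v / 2) (κ ^ L * v / 4 ^ (L + 1)))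
    (by positivity)
  have hs₀v : 2 * ‖s₀‖ < v := by linarith [hs₀ε.trans_le (min_le_left _ _)]
  have hs₀L : 4 ^ (L + 1) * ‖s₀‖ ≤ κ ^ L * v := by
    have := (hs₀ε.trans_le (min_le_right _ _)).le
    rw [le_div_iff₀ (by positivity)] at this
    linarith
  have hball : ∀ s ∈ Metric.ball s₀ (κ * ‖s₀‖), ‖s‖ * K < 1 := fun s hs => by
    have : ‖s‖ < 2 * v := by
      rw [Metric.mem_ball, dist_eq_norm] at hs
      have := norm_le_norm_add_norm_sub' s s₀
      nlinarith
    nlinarith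
  have hbK : ∀ s ∈ Metric.ball (0 : ℂ) (2 * v), ‖s‖ * K ≤ 1 / 2 := fun s hs => by
    rw [mem_ball_zero_iff] at hs
    nlinarith
  set M' := |M| + 2 * C with hM'
  have hest : ∀ m i, ‖η m i‖ ≤ 2 * M' / u₂ ^ i / ‖s₀‖ ^ m := by
    intro m i
    have hsum : ∀ s ∈ Metric.ball (0 : ℂ) (2 * v),
        HasSum (fun m => s ^ m • η m i) (∑' m, s ^ m • η m i) := fun s hs =>
      (summable_pow_smul (C := C / σ ^ i) hK.le (fun m => (hηb m i).trans_eq (by ring))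
        ((hbK s hs).trans_lt (by norm_num))).hasSum
    refine norm_coeff_le_two_disks (c := fun m => η m i) (X := u ^ i) (Y := σ ^ i) (L := L) hκ hκ1 hs₀
      hs₀v hs₀L (by positivity) (by positivity) (by positivity) ?_ hsum ?_ ?_ m
    · rw [← pow_mul, ← pow_mul, mul_comm i, mul_comm i, pow_mul, pow_mul, ← mul_pow]
      gcongr
    · intro s hs
      obtain ⟨hd, hbd, hsm⟩ := hgs s hs
      obtain ⟨γ, hγ⟩ := exists_hasSum_of_differentiableOn hd
      -- For `s` near `s₀` the extension `g · s` has these Taylor coefficients at `z`, by uniqueness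
      -- on the small disk; Cauchy's estimate on the large disk then gives the strong bound.
      have hγE : γ = fun i => ∑' m, s ^ m • η m i :=
        coeff_unique_of_hasSum hσ (fun x hx => hγ x (hsubσ hx)) fun x hx =>
          hasSum_interchange hK.le hσ hηb (hball s hs)
            (by rwa [Metric.mem_ball, dist_eq_norm] at hx) (fun m => hη m x (hsubσ hx)) (hsm x hx)
      have := norm_coeff_le_of_hasSum_ball hu hγ hbd i
      rw [hγE] at this
      refine this.trans ?_
      gcongr
      linarith [le_abs_self M]
    · intro s hs
      have := norm_le_of_hasSum_geometric (B := C / σ ^ i) (t := 1 / 2) (by norm_num) (by norm_num)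
        (hsum s hs) fun m => by
          rw [norm_smul, norm_pow]
          calc ‖s‖ ^ m * ‖η m i‖ ≤ ‖s‖ ^ m * (C * K ^ m / σ ^ i) := by gcongr; exact hηb _ _
            _ = C / σ ^ i * (‖s‖ * K) ^ m := by rw [mul_pow]; ring
            _ ≤ _ := by gcongr; exact hbK s hs
      refine this.trans ?_
      rw [show C / σ ^ i * (1 - 1 / 2)⁻¹ = 2 * C / σ ^ i by ring]
      gcongr
      linarith [abs_nonneg M]
  refine ⟨2 * M' * (1 - max u' 0 / u₂)⁻¹, ‖s₀‖⁻¹, by positivity, fun m x hx => ?_⟩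
  have hxu : ‖x - z‖ ≤ max u' 0 := by
    rw [Metric.mem_ball, dist_eq_norm] at hx
    exact hx.le.trans (le_max_left _ _)
  have := norm_le_of_hasSum_geometric (B := 2 * M' / ‖s₀‖ ^ m) (t := max u' 0 / u₂)
    (by positivity) ((div_lt_one hu₂0).2 hu₂)
    (hη m x (Metric.ball_subset_ball hu'.le hx)) fun i => by
      rw [norm_smul, norm_pow]
      calc ‖x - z‖ ^ i * ‖η m i‖ ≤ max u' 0 ^ i * (2 * M' / u₂ ^ i / ‖s₀‖ ^ m) := by
            gcongr; exact hest m i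
        _ = _ := by rw [div_pow]; ring
  refine this.trans_eq ?_
  rw [inv_pow]; ring

theorem mem_convergentSeries_of_bound [CompleteSpace E] {a : Series₂ E} {C A B : ℝ} (hA : 0 < A)
    (hB : 0 < B) (h : ∀ n m, ‖a n m‖ ≤ C * A ^ n * B ^ m) : a ∈ convergentSeries E := by
  have hC : 0 ≤ C := (norm_nonneg _).trans (by simpa using h 0 0)
  refine ⟨min (1 / A) (1 / B), by positivity, fun x₁ hx₁ x₂ hx₂ => ?_⟩
  rw [mem_ball_zero_iff] at hx₁ hx₂
  have h1 : ‖x₁‖ * A < 1 := (lt_div_iff₀ hA).1 (hx₁.trans_le (min_le_left _ _))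
  have h2 : ‖x₂‖ * B < 1 := (lt_div_iff₀ hB).1 (hx₂.trans_le (min_le_right _ _))
  refine .of_norm_bounded (g := fun P : ℕ × ℕ => (‖x₁‖ * A) ^ P.1 * (C * (‖x₂‖ * B) ^ P.2))
    ((summable_geometric_of_lt_one (by positivity) h1).mul_of_nonneg
      ((summable_geometric_of_lt_one (by positivity) h2).mul_left C)
      (fun _ => by positivity) (fun _ => by positivity)) fun P => ?_
  rw [norm_smul, norm_mul, norm_pow, norm_pow]
  calc ‖x₁‖ ^ P.1 * ‖x₂‖ ^ P.2 * ‖a P.1 P.2‖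
      ≤ ‖x₁‖ ^ P.1 * ‖x₂‖ ^ P.2 * (C * A ^ P.1 * B ^ P.2) := by gcongr; exact h _ _
    _ = _ := by rw [mul_pow, mul_pow]; ring

/-- Cauchy's estimate in `x₁` on the circle turns bounds on the `h m` into geometric bounds on the
double sequence. -/
theorem mem_convergentSeries_of_sphere [CompleteSpace E] {a : Series₂ E} {h : ℕ → ℂ → E}
    {R τ C K : ℝ} (hK : 0 < K) (hτ : 0 < τ) (hτR : τ < R)
    (hh : ∀ m, ∀ x ∈ Metric.ball (0 : ℂ) R, HasSum (fun n => x ^ n • a n m) (h m x))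
    (hb : ∀ m, ∀ x ∈ Metric.sphere (0 : ℂ) τ, ‖h m x‖ ≤ C * K ^ m) : a ∈ convergentSeries E := by
  refine mem_convergentSeries_of_bound (C := C) (A := τ⁻¹) (B := K) (by positivity) hK
    fun n m => ?_
  refine (norm_coeff_le_of_hasSum (z := 0) hτ hτR (fun x hx => by simpa using hh m x hx)
    (hb m) n).trans_eq ?_
  rw [inv_pow]; ring

end Cross

/-! ### Summability in one variable, and the first inclusion. -/

section OneVariable

variable {E : Type*} [NormedAddCommGroup E] [NormedSpace ℂ E]

/-- An interval of length at most `π` embeds in the circle of angles, so finitely many exceptions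
cannot exhaust it. -/
theorem exists_angle_notMem {S : Set Real.Angle} (hS : S.Finite) (θ : ℝ) {η : ℝ} (hη : 0 < η) :
    ∃ d : ℝ, |d - θ| < η ∧ (d : Real.Angle) ∉ S := by
  by_contra! h
  have hπ := Real.pi_pos
  refine Set.infinite_of_injOn_mapsTo (s := Set.Ioo 0 (min η Real.pi))
    (f := fun e : ℝ => ((θ + e : ℝ) : Real.Angle)) ?_ ?_ (Set.Ioo_infinite (by positivity)) hS
  · intro e he e' he' hee
    have : (e : Real.Angle) = e' := by simpa using hee
    rw [← Real.Angle.toReal_coe_eq_self_iff.2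
        ⟨by linarith [he.1], (he.2.trans_le (min_le_right _ _)).le⟩, this,
      Real.Angle.toReal_coe_eq_self_iff.2
        ⟨by linarith [he'.1], (he'.2.trans_le (min_le_right _ _)).le⟩]
  · intro e he
    refine h _ ?_
    rw [add_sub_cancel_left, abs_of_pos he.1]
    exact he.2.trans_le (min_le_left _ _)

theorem IsKSummable.exists_direction {k : ℝ} {c : ℕ → E} (h : IsKSummable k c) :
    ∃ d, IsSummableInDirection k c d := by
  obtain ⟨S, hS, h⟩ := h
  obtain ⟨d, -, hd⟩ := exists_angle_notMem hS 0 one_pos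
  exact ⟨d, h d hd⟩

/-- Continuity of the logarithm at `1`, rescaled by `exp v`. One `κ` works for all `v`, as
`exists_bound_of_cross` demands. -/
theorem exists_log_near {δ : ℝ} (hδ : 0 < δ) :
    ∃ κ : ℝ, 0 < κ ∧ κ ≤ 1 ∧ ∀ v s : ℂ, s ∈ Metric.ball (Complex.exp v) (κ * ‖Complex.exp v‖) →
      s ≠ 0 ∧ s / Complex.exp v ∈ Complex.slitPlane ∧ ‖Complex.log (s / Complex.exp v)‖ < δ ∧
        Complex.exp (v + Complex.log (s / Complex.exp v)) = s := by
  have hc : ContinuousAt Complex.log 1 := continuousAt_clog (by simp)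
  have := Metric.continuousAt_iff.1 hc δ hδ
  obtain ⟨κ, hκ, h⟩ := this
  refine ⟨min κ 1, by positivity, min_le_right _ _, fun v s hs => ?_⟩
  have hv := Complex.exp_ne_zero v
  have hv' : 0 < ‖Complex.exp v‖ := norm_pos_iff.2 hv
  have h1 : dist (s / Complex.exp v) 1 < min κ 1 := by
    rw [dist_eq_norm, div_sub_one hv, norm_div, div_lt_iff₀ hv']
    rwa [Metric.mem_ball, dist_eq_norm] at hs
  have h2 : s / Complex.exp v ∈ Complex.slitPlane :=
    Complex.ball_one_subset_slitPlane (h1.trans_le (min_le_right _ _))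
  have h3 : s ≠ 0 := by
    rintro rfl
    simp at h2
  refine ⟨h3, h2, by simpa using h (h1.trans_le (min_le_left _ _)), ?_⟩
  rw [Complex.exp_add, Complex.exp_log (div_ne_zero h3 hv)]
  field_simp

/-- Uniqueness of Taylor coefficients gives linearity and Cauchy's inequality gives the norm bound,
whose growth in `m` is the source of the geometric rate. -/
theorem exists_taylor_functional [CompleteSpace E] {r : ℝ} (hr : 0 < r) (m : ℕ) :
    ∃ L : Ob r E →L[ℂ] E, (∀ g, ‖L g‖ ≤ (1 / r) ^ m * ‖g‖) ∧
      ∀ (g : Ob r E) (c : ℕ → E),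
        (∀ x : Metric.ball (0 : ℂ) r, HasSum (fun n => (x : ℂ) ^ n • c n) (g.1 x)) →
          L g = c m := by
  have hT : ∀ g : Ob r E, ∃ c : ℕ → E, ∀ x : Metric.ball (0 : ℂ) r,
      HasSum (fun n => (x : ℂ) ^ n • c n) (g.1 x) := fun g => by
    obtain ⟨G, hG, hgG⟩ := g.2
    obtain ⟨c, hc⟩ := exists_hasSum_of_differentiableOn hG
    exact ⟨c, fun x => by simpa [hgG x] using hc x x.2⟩
  choose T hT using hT
  have huniq : ∀ (g : Ob r E) (c : ℕ → E),
      (∀ x : Metric.ball (0 : ℂ) r, HasSum (fun n => (x : ℂ) ^ n • c n) (g.1 x)) → T g = c := by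
    intro g c hc
    obtain ⟨G, hG, hgG⟩ := g.2
    refine coeff_unique_of_hasSum (z := 0) (G := G) hr (fun x hx => ?_) fun x hx => ?_
    · simpa [hgG] using hT g ⟨x, hx⟩
    · simpa [hgG] using hc ⟨x, hx⟩
  have hbound : ∀ g, ‖T g m‖ ≤ (1 / r) ^ m * ‖g‖ := by
    intro g
    obtain ⟨G, hG, hgG⟩ := g.2
    have := norm_coeff_le_of_hasSum_ball (z := 0) (G := G) (B := ‖g‖) hr
      (fun x hx => by simpa [hgG] using hT g ⟨x, hx⟩)
      (fun x hx => by
        rw [← hgG ⟨x, hx⟩]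
        exact g.1.norm_coe_le_norm _) m
    refine this.trans_eq ?_
    rw [one_div, inv_pow]; ring
  let L : Ob r E →ₗ[ℂ] E :=
    { toFun := fun g => T g m
      map_add' := fun g g' => by
        rw [huniq (g + g') (fun n => T g n + T g' n) fun x => by
          simpa using (hT g x).add (hT g' x)]
      map_smul' := fun y g => by
        rw [huniq (y • g) (fun n => y • T g n) fun x => by
          simpa [smul_comm _ y] using (hT g x).const_smul y]
        rfl }
  exact ⟨L.mkContinuous _ hbound, hbound, fun g c hc => congrFun (huniq g c hc) m⟩

theorem exists_evaluation {r : ℝ} (x : Metric.ball (0 : ℂ) r) :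
    ∃ L : Ob r E →L[ℂ] E, ∀ g, L g = g.1 x :=
  ⟨LinearMap.mkContinuous
    { toFun := fun g => g.1 x
      map_add' := fun _ _ => rfl
      map_smul' := fun _ _ => rfl } 1 fun g => by
        simpa using g.1.norm_coe_le_norm x, fun _ => rfl⟩

theorem HasGevreyExpansion.map {F : Type*} [NormedAddCommGroup F] [NormedSpace ℂ F]
    {s a b r : ℝ} {f : ℂ → F} {c : ℕ → F} (h : HasGevreyExpansion s a b r f c) (L : F →L[ℂ] E) :
    HasGevreyExpansion s a b r (fun w => L (f w)) fun n => L (c n) := by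
  intro a' b' r' h1 h2 h3 h4 h5
  obtain ⟨C, hC, A, hA, hCA⟩ := h a' b' r' h1 h2 h3 h4 h5
  refine ⟨(‖L‖ + 1) * C, by positivity, A, hA, fun N w hw => ?_⟩
  have := hCA N w hw
  calc ‖L (f w) - ∑ n ∈ Finset.range N, Complex.exp w ^ n • L (c n)‖
      = ‖L (f w - ∑ n ∈ Finset.range N, Complex.exp w ^ n • c n)‖ := by simp
    _ ≤ ‖L‖ * ‖f w - ∑ n ∈ Finset.range N, Complex.exp w ^ n • c n‖ := L.le_opNorm _
    _ ≤ (‖L‖ + 1) * (C * A ^ N * (N ! : ℝ) ^ s * ‖Complex.exp w‖ ^ N) := by gcongr; linarith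
    _ = _ := by ring

theorem HasGevreyExpansion.norm_le {s a b r a' b' r' : ℝ} {f : ℂ → E} {c : ℕ → E}
    (h : HasGevreyExpansion s a b r f c) (h1 : a < a') (h2 : a' < b') (h3 : b' < b) (h4 : 0 < r')
    (h5 : r' < r) : ∃ C > 0, ∀ w ∈ logSector a' b' r', ‖f w‖ ≤ C := by
  obtain ⟨C, hC, A, hA, hCA⟩ := h a' b' r' h1 h2 h3 h4 h5
  exact ⟨C, hC, fun w hw => by simpa using hCA 0 w hw⟩

theorem exists_exp_small (d : ℝ) {ε : ℝ} (hε : 0 < ε) :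
    ∃ v : ℂ, v.im = d ∧ ‖Complex.exp v‖ < ε :=
  ⟨Complex.mk (Real.log (ε / 2)) d, rfl, by
    rw [Complex.norm_exp, Real.exp_log (by positivity)]; linarith⟩

theorem im_mem_of_norm_lt {v y : ℂ} {d δ : ℝ} (hv : v.im = d) (hy : ‖y‖ < δ) :
    d - δ < (v + y).im ∧ (v + y).im < d + δ := by
  have := (abs_lt.1 ((Complex.abs_im_le_norm y).trans_lt hy))
  rw [Complex.add_im, hv]
  constructor <;> linarith [this.1, this.2]

theorem norm_lt_of_mem_ball {s s₀ : ℂ} {κ : ℝ} (hκ : κ ≤ 1)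
    (hs : s ∈ Metric.ball s₀ (κ * ‖s₀‖)) : ‖s‖ < 2 * ‖s₀‖ := by
  rw [Metric.mem_ball, dist_eq_norm] at hs
  have := norm_le_norm_add_norm_sub' s s₀
  nlinarith [norm_nonneg s₀]

/-- Summability in `x₁` bounds the coefficients `h m`, as functions of `x₁`, close to the origin. -/
theorem exists_geometric_bound_of_isSummableInDirection [CompleteSpace E] {a : Series₂ E}
    {r k d R ρ : ℝ} {c : ℕ → Ob r E} {h : ℕ → ℂ → E} (hr : 0 < r) (hk : 0 < k) (hR : 0 < R)
    (hc : IsExpansionIn 0 r a c) (hd : IsSummableInDirection k c d)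
    (hh : ∀ m, ∀ x ∈ Metric.ball (0 : ℂ) R, HasSum (fun n => x ^ n • a n m) (h m x))
    (hρ : 0 < ρ) :
    ∃ z : ℂ, z ≠ 0 ∧ ‖z‖ < ρ ∧ ∃ σ > 0, ∃ C : ℝ, ∃ K > 0, ∀ m, ∀ x ∈ Metric.ball z σ,
      ‖h m x‖ ≤ C * K ^ m := by
  obtain ⟨α, β, r₁, hr₁, hαβ, hαβd, f, hf, hG⟩ := hd
  have hπk : 0 < Real.pi / k := div_pos Real.pi_pos hk
  set δ := (β - α) / 4 with hδ
  have hδ0 : 0 < δ := by rw [hδ]; linarith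
  obtain ⟨C, hC, hfC⟩ := hG.norm_le (a' := α + δ) (b' := β - δ) (r' := r₁ / 2) (by linarith)
    (by linarith) (by linarith) (by linarith) (by linarith)
  obtain ⟨κ, hκ, hκ1, hlog⟩ := exists_log_near hδ0
  obtain ⟨v, hvd, hv⟩ := exists_exp_small d (ε := min ρ (min (r₁ / 2) (R / 2) / 2))
    (by positivity)
  have hvR : 2 * ‖Complex.exp v‖ < min (r₁ / 2) (R / 2) := by
    linarith [hv.trans_le (min_le_right _ _)]
  have hv0 : 0 < ‖Complex.exp v‖ := norm_pos_iff.2 (Complex.exp_ne_zero v)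
  refine ⟨Complex.exp v, Complex.exp_ne_zero v, hv.trans_le (min_le_left _ _),
    κ * ‖Complex.exp v‖, by positivity, C, 1 / r, by positivity, fun m x hx => ?_⟩
  obtain ⟨hx0, -, hlogx, hexp⟩ := hlog v x hx
  have hxn := (norm_lt_of_mem_ball hκ1 hx).trans hvR
  set w := v + Complex.log (x / Complex.exp v) with hw
  have hwim := im_mem_of_norm_lt hvd hlogx
  have hwre : Real.exp w.re = ‖x‖ := by rw [← Complex.norm_exp, hexp]
  have hwS : w ∈ logSector (α + δ) (β - δ) (r₁ / 2) :=
    ⟨by rw [hwre]; exact hxn.trans_le (min_le_left _ _), by linarith [hwim.1],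
      by linarith [hwim.2]⟩
  obtain ⟨L, hL, hLc⟩ := exists_taylor_functional (E := E) hr m
  have hLcn : ∀ n, L (c n) = a n m := fun n => hLc (c n) (fun m => a n m) (hc n)
  -- This `B` may depend on `m`: it only certifies convergence of the expansion of `h m`, so that `h
  -- m = L ∘ f` on the sector. The final bound comes from `‖L‖ ≤ r⁻ᵐ`.
  obtain ⟨B, hB⟩ : ∃ B, ∀ x ∈ Metric.sphere (0 : ℂ) (R / 2), ‖h m x‖ ≤ B :=
    (isCompact_sphere _ _).exists_bound_of_continuousOn
      ((differentiableOn_of_hasSum (z := 0) hR fun x hx => by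
        simpa using hh m x hx).continuousOn.mono (Metric.sphere_subset_ball (by linarith)))
  have hsum := hasSum_of_hasGevreyExpansion hk hαβ
    (L.differentiable.comp_differentiableOn hf) (hG.map L) (C₀ := B) (B := 2 / R)
    (by positivity) (fun n => by
      rw [hLcn]
      refine (norm_coeff_le_of_hasSum (z := 0) (ρ := R / 2) (half_pos hR) (half_lt_self hR)
        (fun x hx => by simpa using hh m x hx) hB n).trans_eq ?_
      rw [div_pow, div_pow]; field_simp)
    (w := w) (logSector_subset (by linarith) (by linarith) (by linarith) hwS) (by
      rw [hexp, mul_div_assoc', div_lt_one hR]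
      linarith [hxn.trans_le (min_le_right _ _)])
  simp only [hLcn, hexp] at hsum
  have hxR : x ∈ Metric.ball (0 : ℂ) R := by
    rw [mem_ball_zero_iff]; linarith [hxn.trans_le (min_le_right _ _)]
  rw [(hh m x hxR).unique hsum]
  calc ‖L (f w)‖ ≤ (1 / r) ^ m * ‖f w‖ := hL _
    _ ≤ (1 / r) ^ m * C := by gcongr; exact hfC w hwS
    _ = _ := mul_comm _ _

/-- Near some small `z` the series in `x₂` converges, and by Watson's lemma its sum is the function
obtained from summability in `x₂`, which is bounded and holomorphic in `x₁` on all of `D_{r'}`. This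
is the situation of `exists_bound_of_cross`. -/
theorem convergent_of_summableInVariable [CompleteSpace E] {a : Series₂ E} {k l r r' : ℝ}
    (hk : 0 < k) (hl : 0 < l) (hr : 0 < r) (hr' : 0 < r') (h0 : a ∈ summableInVariable E 0 r k)
    (h1 : a ∈ summableInVariable E 1 r' l) : a ∈ convergentSeries E := by
  obtain ⟨c, hc, hcS⟩ := h0
  obtain ⟨c', hc', hcS'⟩ := h1
  obtain ⟨d, hd⟩ := hcS.exists_direction
  obtain ⟨d', α, β, r₁, hr₁, hαβ, hαβd, f, hf, hG⟩ := hcS'.exists_direction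
  choose h hhd hh using fun m => (c' m).2
  have hhs : ∀ m, ∀ x ∈ Metric.ball (0 : ℂ) r', HasSum (fun n => x ^ n • a n m) (h m x) :=
    fun m x hx => by simpa [hh, slice] using hc' m ⟨x, hx⟩
  obtain ⟨z, hz0, hzr, σ, hσ, C, K, hK, hb⟩ :=
    exists_geometric_bound_of_isSummableInDirection hr hk hr' hc hd hhs (half_pos hr')
  have hsub : Metric.ball z (r' / 2) ⊆ Metric.ball 0 r' :=
    Metric.ball_subset_ball' (by rw [dist_zero_right]; linarith)
  have hπl : 0 < Real.pi / l := div_pos Real.pi_pos hl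
  set δ := (β - α) / 4 with hδ
  have hδ0 : 0 < δ := by rw [hδ]; linarith
  obtain ⟨M, hM, hfM⟩ := hG.norm_le (a' := α + δ) (b' := β - δ) (r' := r₁ / 2) (by linarith)
    (by linarith) (by linarith) (by linarith) (by linarith)
  obtain ⟨κ, hκ, hκ1, hlog⟩ := exists_log_near hδ0
  choose F hFd hF using fun w => (f w).2
  -- As `u' > ‖z‖`, the disk of radius `u'` about `z` contains a circle around the origin.
  obtain ⟨u', hu', hu'r⟩ := exists_between hzr
  obtain ⟨C', K', hK', hb'⟩ := exists_bound_of_cross (u := r' / 2) (σ := min σ (r' / 2)) (z := z)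
    (h := h) (lt_min hσ (half_pos hr')) (min_le_right _ _) hK hκ hκ1
    (fun m => (hhd m).mono hsub)
    (fun m x hx => hb m x (Metric.ball_subset_ball (min_le_left _ _) hx)) (fun ε hε => by
      obtain ⟨v, hvd, hv⟩ := exists_exp_small d' (ε := min ε (min (r₁ / 2) (1 / K) / 2))
        (by positivity)
      have hv2 : 2 * ‖Complex.exp v‖ < min (r₁ / 2) (1 / K) := by
        linarith [hv.trans_le (min_le_right _ _)]
      refine ⟨Complex.exp v, norm_pos_iff.2 (Complex.exp_ne_zero v),
        hv.trans_le (min_le_left _ _), M,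
        fun x s => F (v + Complex.log (s / Complex.exp v)) x, fun s hs => ?_⟩
      obtain ⟨hs0, -, hlogs, hexp⟩ := hlog v s hs
      have hsn := (norm_lt_of_mem_ball hκ1 hs).trans hv2
      set w := v + Complex.log (s / Complex.exp v) with hw
      have hwim := im_mem_of_norm_lt hvd hlogs
      have hwre : Real.exp w.re = ‖s‖ := by rw [← Complex.norm_exp, hexp]
      have hwS : w ∈ logSector (α + δ) (β - δ) (r₁ / 2) :=
        ⟨by rw [hwre]; exact hsn.trans_le (min_le_left _ _), by linarith [hwim.1],
          by linarith [hwim.2]⟩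
      refine ⟨(hFd w).mono hsub, fun x hx => ?_, fun x hx => ?_⟩
      · change ‖F w x‖ ≤ M
        rw [← hF w ⟨x, hsub hx⟩]
        exact ((f w).1.norm_coe_le_norm _).trans (hfM w hwS)
      · have hxr : x ∈ Metric.ball (0 : ℂ) r' :=
          hsub (Metric.ball_subset_ball (min_le_right _ _) hx)
        obtain ⟨L, hL⟩ := exists_evaluation (E := E) ⟨x, hxr⟩
        have hLc : ∀ m, L (c' m) = h m x := fun m => by rw [hL, hh]
        have hsum := hasSum_of_hasGevreyExpansion hl hαβ
          (L.differentiable.comp_differentiableOn hf) (hG.map L) (C₀ := C) (B := K) hK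
          (fun m => by
            rw [hLc]; exact hb m x (Metric.ball_subset_ball (min_le_left _ _) hx))
          (w := w) (logSector_subset (by linarith) (by linarith) (by linarith) hwS) (by
            rw [hexp, ← lt_div_iff₀ hK]; exact hsn.trans_le (min_le_right _ _))
        simp only [hLc, hexp, Function.comp, hL, hF] at hsum
        exact hsum) hu'r
  have hτ : 0 < (u' - ‖z‖) / 2 := by linarith
  refine mem_convergentSeries_of_sphere (τ := (u' - ‖z‖) / 2) hK' hτ
    (by linarith [norm_nonneg z]) hhs fun m x hx => hb' m x ?_
  rw [mem_sphere_zero_iff_norm] at hx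
  rw [Metric.mem_ball, dist_eq_norm]
  linarith [norm_sub_le x z]

end OneVariable

/-! ### The decomposition into powers of the monomial, and bounds for `f_n`. -/

section Blocks

variable {E : Type*} [NormedAddCommGroup E] [NormedSpace ℂ E]

/-- The monomial `x₁ⁱ x₂ʲ` belongs to the block of index `min (i/p) (j/q)`, integer quotients; thus
the blocks partition all indices. -/
theorem min_div_add_eq_iff {p q : ℕ} (hp : 0 < p) (hq : 0 < q) (n m j : ℕ) :
    min ((n * p + m) / p) ((n * q + j) / q) = n ↔ m < p ∨ j < q := by
  rw [mul_comm n p, mul_comm n q, Nat.mul_add_div hp, Nat.mul_add_div hq, ← Nat.div_eq_zero_iff_lt hp,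
    ← Nat.div_eq_zero_iff_lt hq]
  generalize m / p = u
  generalize j / q = v
  omega

/-- The terms of `f_n (x₁ᵖ x₂^q)ⁿ` are the terms of `a` with index in the `n`-th hook. -/
theorem hasSum_hook {p q : ℕ} (hp : 0 < p) (hq : 0 < q) {a : Series₂ E} {x₁ x₂ : ℂ} {n : ℕ} {y : E}
    (h : HasSum (fun P : ℕ × ℕ => (x₁ ^ P.1 * x₂ ^ P.2) • block p q a n P.1 P.2) y) :
    HasSum (fun P : ℕ × ℕ => if min (P.1 / p) (P.2 / q) = n then
      (x₁ ^ P.1 * x₂ ^ P.2) • a P.1 P.2 else 0) ((x₁ ^ p * x₂ ^ q) ^ n • y) := by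
  have hinj : Function.Injective fun P : ℕ × ℕ => (n * p + P.1, n * q + P.2) := by
    rintro ⟨i, j⟩ ⟨i', j'⟩ h
    simpa using h
  refine (hinj.hasSum_iff ?_).1 ?_
  · rintro ⟨i, j⟩ hij
    refine if_neg fun hmin => hij ?_
    dsimp only at hmin
    have h1 : n * p ≤ i := (Nat.le_div_iff_mul_le hp).1 (by omega)
    have h2 : n * q ≤ j := (Nat.le_div_iff_mul_le hq).1 (by omega)
    exact ⟨(i - n * p, j - n * q), by simp [Nat.add_sub_cancel' h1, Nat.add_sub_cancel' h2]⟩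
  · convert h.const_smul ((x₁ ^ p * x₂ ^ q) ^ n) using 1
    funext P
    simp only [Function.comp, min_div_add_eq_iff hp hq, block]
    split_ifs
    · rw [smul_smul]
      congr 1
      rw [pow_add, pow_add, mul_pow, mul_comm n p, mul_comm n q, pow_mul, pow_mul]
      ring
    · simp

theorem hasSum_hooks {p q : ℕ} (hp : 0 < p) (hq : 0 < q) {a : Series₂ E} {x₁ x₂ : ℂ}
    {y : ℕ → E} (N : ℕ)
    (h : ∀ n, HasSum (fun P : ℕ × ℕ => (x₁ ^ P.1 * x₂ ^ P.2) • block p q a n P.1 P.2) (y n)) :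
    HasSum (fun P : ℕ × ℕ => if min (P.1 / p) (P.2 / q) < N then
      (x₁ ^ P.1 * x₂ ^ P.2) • a P.1 P.2 else 0)
      (∑ n ∈ Finset.range N, (x₁ ^ p * x₂ ^ q) ^ n • y n) := by
  convert hasSum_sum fun n (_ : n ∈ Finset.range N) => hasSum_hook hp hq (h n) using 1
  funext P
  simp

/-- Expansion in powers of `x₂` of `∑_{n < N} f_n (x₁ᵖ x₂^q)ⁿ`. -/
theorem hasSum_partial_sum {p q : ℕ} (hp : 0 < p) (hq : 0 < q) {a : Series₂ E} {x₁ x₂ : ℂ}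
    {y : ℕ → E} {h : ℕ → E} (N : ℕ)
    (hy : ∀ n, HasSum (fun P : ℕ × ℕ => (x₁ ^ P.1 * x₂ ^ P.2) • block p q a n P.1 P.2) (y n))
    (hh : ∀ m, HasSum (fun n => x₁ ^ n • a n m) (h m)) :
    HasSum (fun m => x₂ ^ m • if m < q * N then h m else ∑ n ∈ Finset.range (p * N), x₁ ^ n • a n m)
      (∑ n ∈ Finset.range N, (x₁ ^ p * x₂ ^ q) ^ n • y n) := by
  have h1 : HasSum (fun P : ℕ × ℕ => if min (P.2 / p) (P.1 / q) < N then
      (x₁ ^ P.2 * x₂ ^ P.1) • a P.2 P.1 else 0)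
      (∑ n ∈ Finset.range N, (x₁ ^ p * x₂ ^ q) ^ n • y n) :=
    (Equiv.hasSum_iff (Equiv.prodComm ℕ ℕ) (f := fun P : ℕ × ℕ =>
      if min (P.1 / p) (P.2 / q) < N then (x₁ ^ P.1 * x₂ ^ P.2) • a P.1 P.2 else 0)).2
      (hasSum_hooks hp hq N hy)
  refine HasSum.prod_fiberwise h1 fun m => ?_
  dsimp only
  -- For `m < qN` all terms in `x₂ᵐ` lie in hooks of index below `N`, so the full `h m` appears; for
  -- `m ≥ qN` only the powers `x₁ⁿ` with `n < pN` remain.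
  split_ifs with hm
  · have : m / q < N := (Nat.div_lt_iff_lt_mul hq).2 (by linarith)
    convert (hh m).const_smul (x₂ ^ m) using 1
    funext n
    rw [if_pos (by omega), smul_smul, mul_comm]
  · have hmN : N ≤ m / q := (Nat.le_div_iff_mul_le hq).2 (by linarith)
    have hn : ∀ n, min (n / p) (m / q) < N ↔ n ∈ Finset.range (p * N) := fun n => by
      rw [Finset.mem_range, mul_comm, ← Nat.div_lt_iff_lt_mul hp]
      omega
    simp only [hn]
    have h2 : HasSum (fun n => if n ∈ Finset.range (p * N) then (x₁ ^ n * x₂ ^ m) • a n m else 0)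
        (∑ n ∈ Finset.range (p * N), if n ∈ Finset.range (p * N) then
          (x₁ ^ n * x₂ ^ m) • a n m else 0) :=
      hasSum_sum_of_ne_finset_zero fun n hn => if_neg hn
    convert h2 using 1
    rw [Finset.smul_sum]
    refine Finset.sum_congr rfl fun n hn => ?_
    rw [if_pos hn, smul_smul, mul_comm]

/-- Schwarz' lemma for a zero of order `N`. -/
theorem norm_le_of_coeff_zero [CompleteSpace E] {c : ℕ → E} {G : ℂ → E} {R ρ B : ℝ} {N : ℕ}
    (hρ : 0 < ρ) (hρR : ρ < R)
    (h : ∀ s ∈ Metric.ball (0 : ℂ) R, HasSum (fun n => s ^ n • c n) (G s))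
    (hc : ∀ n < N, c n = 0) (hB : ∀ s ∈ Metric.sphere (0 : ℂ) ρ, ‖G s‖ ≤ B) {s : ℂ}
    (hs : ‖s‖ ≤ ρ / 2) : ‖G s‖ ≤ 2 * B * (‖s‖ / ρ) ^ N := by
  have h1 := norm_coeff_le_of_hasSum (z := 0) hρ hρR (fun s hs => by simpa using h s hs) hB
  have h2 := norm_sub_sum_range_le (C := B) (B := ρ⁻¹) (t := 1 / 2) (x := s) (by positivity)
    (fun n => (h1 n).trans_eq (by rw [inv_pow]; rfl))
    (by rw [← div_eq_mul_inv, div_le_iff₀ hρ]; linarith) (by norm_num)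
    (h s (by rw [mem_ball_zero_iff]; linarith)) N
  rw [Finset.sum_eq_zero fun n hn => by rw [hc n (Finset.mem_range.1 hn), smul_zero],
    sub_zero] at h2
  refine h2.trans_eq ?_
  rw [div_pow, inv_pow]; ring

theorem add_one_rpow_le (n : ℕ) {s : ℝ} (hs : 0 ≤ s) : ((n + 1 : ℕ) : ℝ) ^ s ≤ (2 ^ s) ^ n := by
  rw [← Real.rpow_natCast, ← Real.rpow_mul (by norm_num), mul_comm s, Real.rpow_mul (by norm_num),
    Real.rpow_natCast]
  exact Real.rpow_le_rpow (by positivity) (by exact_mod_cast n.lt_two_pow_self) hs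

/-- The term `tⁿ yₙ` is the difference of the remainders of orders `n` and `n + 1`; the growth of
the factorial is absorbed by `(n + 1)^s ≤ (2^s)ⁿ`. -/
theorem norm_term_le {f : E} {y : ℕ → E} {t : ℂ} {C A s : ℝ} (hC : 0 < C) (hA : 0 < A)
    (hs : 0 ≤ s) (ht : t ≠ 0) (ht1 : ‖t‖ ≤ 1)
    (h : ∀ N : ℕ, ‖f - ∑ n ∈ Finset.range N, t ^ n • y n‖
      ≤ C * A ^ N * (N ! : ℝ) ^ s * ‖t‖ ^ N) (n : ℕ) :
    ‖y n‖ ≤ (C * (1 + A) + 1 + A * 2 ^ s) ^ (n + 1) * (n ! : ℝ) ^ s := by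
  have ht0 : 0 < ‖t‖ := norm_pos_iff.2 ht
  set D : ℝ := 2 ^ s with hD
  have hD1 : 1 ≤ D := Real.one_le_rpow (by norm_num) hs
  set T := (n ! : ℝ) ^ s with hT
  have hT0 : 0 < T := by positivity
  have h1 : ((n + 1)! : ℝ) ^ s ≤ D ^ n * T := by
    rw [Nat.factorial_succ, Nat.cast_mul, Real.mul_rpow (by positivity) (by positivity)]
    gcongr
    exact add_one_rpow_le n hs
  have h2 : ‖t‖ ^ n * ‖y n‖ ≤ ‖t‖ ^ n * (C * A ^ n * T + C * A ^ (n + 1) * (D ^ n * T)) := by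
    calc ‖t‖ ^ n * ‖y n‖ = ‖(f - ∑ n ∈ Finset.range n, t ^ n • y n)
          - (f - ∑ n ∈ Finset.range (n + 1), t ^ n • y n)‖ := by
          rw [Finset.sum_range_succ, ← norm_pow, ← norm_smul]
          congr 1; abel
      _ ≤ _ := norm_sub_le _ _
      _ ≤ C * A ^ n * T * ‖t‖ ^ n + C * A ^ (n + 1) * ((n + 1)! : ℝ) ^ s * ‖t‖ ^ (n + 1) :=
          add_le_add (h n) (h (n + 1))
      _ ≤ C * A ^ n * T * ‖t‖ ^ n + C * A ^ (n + 1) * (D ^ n * T) * ‖t‖ ^ n := by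
          gcongr _ + _ * ?_ * ?_
          exact pow_le_pow_of_le_one ht0.le ht1 n.le_succ
      _ = _ := by ring
  refine (le_of_mul_le_mul_left h2 (by positivity)).trans ?_
  calc C * A ^ n * T + C * A ^ (n + 1) * (D ^ n * T)
      ≤ C * (A ^ n * D ^ n) * T + C * A ^ (n + 1) * (D ^ n * T) := by
        gcongr
        exact le_mul_of_one_le_right (by positivity) (one_le_pow₀ hD1)
    _ = (C * (1 + A)) * (A * D) ^ n * T := by rw [mul_pow]; ring
    _ ≤ (C * (1 + A) + 1 + A * D) * (C * (1 + A) + 1 + A * D) ^ n * T := by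
        have h0 : 0 < C * (1 + A) := by positivity
        have h0' : 0 < A * D := by positivity
        gcongr <;> linarith
    _ = _ := by rw [pow_succ]; ring

theorem pow_lt_of_lt_of_le_one {x ρ : ℝ} (hx : 0 ≤ x) (h : x < ρ) (h1 : x ≤ 1) {p : ℕ}
    (hp : 0 < p) : x ^ p < ρ :=
  (pow_le_of_le_one hx h1 hp.ne').trans_lt h

/-- The coefficients `f_n` satisfy Gevrey estimates uniformly near the origin. -/
theorem exists_block_bound {p q : ℕ} (hp : 0 < p) (hq : 0 < q) {l : ℝ} (hl : 0 < l)
    {a : Series₂ E} (ha : a ∈ summableInMonomial E p q l) :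
    ∃ ρ > 0, ∃ B > 0, ∀ (n : ℕ) (x₁ x₂ : ℂ) (y : E), x₁ ≠ 0 → x₂ ≠ 0 → ‖x₁‖ < ρ → ‖x₂‖ < ρ →
      HasSum (fun P : ℕ × ℕ => (x₁ ^ P.1 * x₂ ^ P.2) • block p q a n P.1 P.2) y →
        ‖y‖ ≤ B ^ (n + 1) * (n ! : ℝ) ^ (1 / l) := by
  obtain ⟨-, S, hS, hd⟩ := ha
  let Q : Set ℝ → Prop := fun s => ∃ ρ > 0, ∃ B > 0, ∀ (n : ℕ) (x₁ x₂ t : ℂ) (y : E),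
    Complex.exp t = x₁ ^ p * x₂ ^ q → t.im ∈ s → ‖x₁‖ < ρ → ‖x₂‖ < ρ →
      HasSum (fun P : ℕ × ℕ => (x₁ ^ P.1 * x₂ ^ P.2) • block p q a n P.1 P.2) y →
        ‖y‖ ≤ B ^ (n + 1) * (n ! : ℝ) ^ (1 / l)
  -- The values `f_n (x₁, x₂)` do not depend on the determination of the argument, so one period
  -- suffices and compactness leaves finitely many sectors.
  have hQ : Q (Set.Icc (-Real.pi) Real.pi) := by
    refine isCompact_Icc.induction_on (p := Q) ?_ ?_ ?_ ?_
    · exact ⟨1, one_pos, 1, one_pos, fun n x₁ x₂ t y _ h => h.elim⟩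
    · rintro s s' hss' ⟨ρ, hρ, B, hB, h⟩
      exact ⟨ρ, hρ, B, hB, fun n x₁ x₂ t y he ht => h n x₁ x₂ t y he (hss' ht)⟩
    · rintro s s' ⟨ρ, hρ, B, hB, h⟩ ⟨ρ', hρ', B', hB', h'⟩
      refine ⟨min ρ ρ', lt_min hρ hρ', max B B', lt_max_of_lt_left hB,
        fun n x₁ x₂ t y he ht h1 h2 hy => ?_⟩
      rcases ht with ht | ht
      · refine (h n x₁ x₂ t y he ht (h1.trans_le (min_le_left _ _))
          (h2.trans_le (min_le_left _ _)) hy).trans ?_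
        gcongr
        exact le_max_left _ _
      · refine (h' n x₁ x₂ t y he ht (h1.trans_le (min_le_right _ _))
          (h2.trans_le (min_le_right _ _)) hy).trans ?_
        gcongr
        exact le_max_right _ _
    · intro θ _
      have hπl : 0 < Real.pi / l := div_pos Real.pi_pos hl
      -- Even if `θ` is exceptional, a sector of opening greater than `π/l` bisected by a direction
      -- within `π/(2l)` of `θ` contains `θ`.
      obtain ⟨d, hdθ, hdS⟩ := exists_angle_notMem hS θ (half_pos hπl)
      obtain ⟨α, β, r, hr, hαβ, hαβd, f, -, R, hR, hRr, g, hg, hest⟩ := hd d hdS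
      rw [abs_lt] at hdθ
      obtain ⟨α', h1, h2⟩ := exists_between (show α < θ by linarith [hdθ.2])
      obtain ⟨β', h3, h4⟩ := exists_between (show θ < β by linarith [hdθ.1])
      obtain ⟨C, hC, A, hA, hCA⟩ := hest α' β' (R / 2) h1 (h2.trans h3) h4 (half_pos hR)
        (half_lt_self hR)
      refine ⟨Set.Ioo α' β', mem_nhdsWithin_of_mem_nhds (Ioo_mem_nhds h2 h3), min (R / 2) 1,
        by positivity, C * (1 + A) + 1 + A * 2 ^ (1 / l), by positivity,
        fun n x₁ x₂ t y he ht hx₁ hx₂ hy => ?_⟩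
      have hx₁R := hx₁.trans_le (min_le_left _ _)
      have hx₂R := hx₂.trans_le (min_le_left _ _)
      have hx₁1 := (hx₁.trans_le (min_le_right _ _)).le
      have hx₂1 := (hx₂.trans_le (min_le_right _ _)).le
      have hne : x₁ ^ p * x₂ ^ q ≠ 0 := he ▸ Complex.exp_ne_zero t
      have hyg : ∀ n, HasSum (fun P : ℕ × ℕ => (x₁ ^ P.1 * x₂ ^ P.2) • block p q a n P.1 P.2)
          (g n (x₁, x₂)) := fun n => (hg n).2.2 (x₁, x₂)
        ⟨by rw [mem_ball_zero_iff]; linarith, by rw [mem_ball_zero_iff]; linarith⟩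
      rw [hy.unique (hyg n)]
      refine norm_term_le (f := f (x₁, x₂, t)) (y := fun n => g n (x₁, x₂)) (t := x₁ ^ p * x₂ ^ q)
        hC hA (by positivity) hne ?_ (fun N => hCA N (x₁, x₂, t) ⟨he, ?_, ?_, ?_, ?_, ht.1, ht.2⟩
          (by dsimp only; linarith) (by dsimp only; linarith)) n
      · rw [norm_mul, norm_pow, norm_pow]
        exact mul_le_one₀ (pow_le_one₀ (norm_nonneg _) hx₁1) (by positivity)
          (pow_le_one₀ (norm_nonneg _) hx₂1)
      · rw [← norm_pow]; exact norm_pos_iff.2 (left_ne_zero_of_mul hne)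
      · exact pow_lt_of_lt_of_le_one (norm_nonneg _) hx₁R hx₁1 hp
      · rw [← norm_pow]; exact norm_pos_iff.2 (right_ne_zero_of_mul hne)
      · exact pow_lt_of_lt_of_le_one (norm_nonneg _) hx₂R hx₂1 hq
  obtain ⟨ρ, hρ, B, hB, h⟩ := hQ
  refine ⟨ρ, hρ, B, hB, fun n x₁ x₂ y h1 h2 => h n x₁ x₂ (Complex.log (x₁ ^ p * x₂ ^ q)) y
    (Complex.exp_log (mul_ne_zero (pow_ne_zero _ h1) (pow_ne_zero _ h2))) ?_⟩
  rw [Complex.log_im]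
  exact ⟨(Complex.neg_pi_lt_arg _).le, Complex.arg_le_pi _⟩

end Blocks

/-! ### Identifying the monomial sum with a convergent series in `x₂`. -/

section Identification

variable {E : Type*} [NormedAddCommGroup E] [NormedSpace ℂ E]

theorem sum_range_le_geometric {y : ℕ → E} {t : ℂ} {B s : ℝ} (hs : 0 ≤ s) (hB : 0 < B)
    (ht : ‖t‖ ≤ 1) (hy : ∀ n, ‖y n‖ ≤ B ^ (n + 1) * (n ! : ℝ) ^ s) (N : ℕ) :
    ‖∑ n ∈ Finset.range N, t ^ n • y n‖ ≤ (2 * (B + 1)) ^ N * (N ! : ℝ) ^ s := by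
  have h1 : ∀ n ∈ Finset.range N, ‖t ^ n • y n‖ ≤ (B + 1) ^ N * (N ! : ℝ) ^ s := fun n hn => by
    have hnN := Finset.mem_range.1 hn
    rw [norm_smul, norm_pow]
    calc ‖t‖ ^ n * ‖y n‖ ≤ 1 * (B ^ (n + 1) * (n ! : ℝ) ^ s) := by
          gcongr
          · exact pow_le_one₀ (norm_nonneg _) ht
          · exact hy n
      _ ≤ 1 * ((B + 1) ^ (n + 1) * (n ! : ℝ) ^ s) := by gcongr; linarith
      _ ≤ 1 * ((B + 1) ^ N * (N ! : ℝ) ^ s) := by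
          gcongr
          · linarith
          · exact hnN
      _ = _ := one_mul _
  calc _ ≤ ∑ n ∈ Finset.range N, (B + 1) ^ N * (N ! : ℝ) ^ s := norm_sum_le_of_le _ h1
    _ = N * ((B + 1) ^ N * (N ! : ℝ) ^ s) := by simp
    _ ≤ 2 ^ N * ((B + 1) ^ N * (N ! : ℝ) ^ s) := by
        gcongr
        exact_mod_cast N.lt_two_pow_self.le
    _ = _ := by rw [mul_pow]; ring

/-- For fixed `x₁`, the sum of `∑ h m x₂ᵐ` minus the partial sum of order `N` has a zero of order
`qN` at `x₂ = 0` and is at most geometric times `N!^s` on `‖x₂‖ = ρ₂`. Schwarz' lemma contributes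
`(‖x₂‖/ρ₂)^(qN)`, which is the `N`-th power of `‖x₁ᵖ x₂^q‖ / (‖x₁‖ᵖ ρ₂^q)`. The bounds on the `f_n`
must hold on the whole circle, hence in all directions. -/
theorem norm_sub_le_flat [CompleteSpace E] {p q : ℕ} (hp : 0 < p) (hq : 0 < q) {a : Series₂ E}
    {x₁ x₂ : ℂ} {ρ ρ₂ B C C' A K s : ℝ} {g : ℕ → ℂ → E} {h : ℕ → E} {v F : E} (hs : 0 ≤ s)
    (hx₁ : x₁ ≠ 0) (hx₁ρ : ‖x₁‖ < ρ) (hρ1 : ρ ≤ 1) (hρ₂ : 0 < ρ₂) (hρ₂ρ : ρ₂ < ρ)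
    (hx₂ρ : ‖x₂‖ ≤ ρ₂ / 2) (hB : 0 < B) (hK : 0 < K) (hρ₂K : ρ₂ * K ≤ 1 / 2) (hC' : 0 < C')
    (hA : 0 < A)
    (hg : ∀ n y, ‖y‖ < ρ →
      HasSum (fun P : ℕ × ℕ => (x₁ ^ P.1 * y ^ P.2) • block p q a n P.1 P.2) (g n y))
    (hgB : ∀ n y, y ≠ 0 → ‖y‖ < ρ → ‖g n y‖ ≤ B ^ (n + 1) * (n ! : ℝ) ^ s)
    (hh : ∀ m, HasSum (fun n => x₁ ^ n • a n m) (h m)) (hhC : ∀ m, ‖h m‖ ≤ C * K ^ m) (N : ℕ)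
    (hv : ‖v - ∑ n ∈ Finset.range N, (x₁ ^ p * x₂ ^ q) ^ n • g n x₂‖
      ≤ C' * A ^ N * (N ! : ℝ) ^ s * ‖x₁ ^ p * x₂ ^ q‖ ^ N)
    (hF : HasSum (fun m => x₂ ^ m • h m) F) :
    ‖v - F‖ ≤ (C' + 2 * (2 * C + 1)) * (max A (2 * (B + 1) / (‖x₁‖ ^ p * ρ₂ ^ q))) ^ N *
      (N ! : ℝ) ^ s * ‖x₁ ^ p * x₂ ^ q‖ ^ N := by
  have hC : 0 ≤ C := (norm_nonneg _).trans (by simpa using hhC 0)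
  have hx₁0 : 0 < ‖x₁‖ := norm_pos_iff.2 hx₁
  set R := min ρ (1 / K) with hR
  have hρ₂R : ρ₂ < R := lt_min hρ₂ρ (by rw [lt_div_iff₀ hK]; linarith)
  have hsum : ∀ y ∈ Metric.ball (0 : ℂ) R, HasSum (fun m => y ^ m • h m) (∑' m, y ^ m • h m) :=
    fun y hy => by
      rw [mem_ball_zero_iff] at hy
      exact (summable_pow_smul hK.le hhC
        ((lt_div_iff₀ hK).1 (hy.trans_le (min_le_right _ _)))).hasSum
  have hdiff : ∀ y ∈ Metric.ball (0 : ℂ) R, HasSum (fun m => y ^ m • (h m -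
      if m < q * N then h m else ∑ n ∈ Finset.range (p * N), x₁ ^ n • a n m))
      (∑' m, y ^ m • h m - ∑ n ∈ Finset.range N, (x₁ ^ p * y ^ q) ^ n • g n y) := fun y hy => by
    have h1 := (hsum y hy).sub (hasSum_partial_sum hp hq N (fun n => hg n y
      ((mem_ball_zero_iff.1 hy).trans_le (min_le_left _ _))) hh)
    simpa only [← smul_sub] using h1
  have hsphere : ∀ y ∈ Metric.sphere (0 : ℂ) ρ₂,
      ‖∑' m, y ^ m • h m - ∑ n ∈ Finset.range N, (x₁ ^ p * y ^ q) ^ n • g n y‖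
        ≤ (2 * C + 1) * ((2 * (B + 1)) ^ N * (N ! : ℝ) ^ s) := fun y hy => by
    rw [mem_sphere_zero_iff_norm] at hy
    have hyR : y ∈ Metric.ball (0 : ℂ) R := by rwa [mem_ball_zero_iff, hy]
    have h1 := norm_le_of_hasSum_geometric (B := C) (t := 1 / 2) (by norm_num) (by norm_num)
      (hsum y hyR) fun m => by
        rw [norm_smul, norm_pow, hy]
        calc ρ₂ ^ m * ‖h m‖ ≤ ρ₂ ^ m * (C * K ^ m) := by gcongr; exact hhC m
          _ = C * (ρ₂ * K) ^ m := by ring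
          _ ≤ _ := by gcongr
    have hy0 : y ≠ 0 := by rintro rfl; simp at hy; linarith
    have ht : ‖x₁ ^ p * y ^ q‖ ≤ 1 := by
      rw [norm_mul, norm_pow, norm_pow, hy]
      exact mul_le_one₀ (pow_le_one₀ hx₁0.le (by linarith)) (by positivity)
        (pow_le_one₀ hρ₂.le (by linarith))
    have h2 := sum_range_le_geometric hs hB ht
      (fun n => hgB n y hy0 (by rw [hy]; exact hρ₂ρ)) N
    have h3 : 1 ≤ (2 * (B + 1)) ^ N * (N ! : ℝ) ^ s :=
      one_le_mul_of_one_le_of_one_le (one_le_pow₀ (by linarith)) (one_le_factorial_rpow N hs)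
    refine (norm_sub_le _ _).trans ((add_le_add h1 h2).trans ?_)
    nlinarith
  have h1 := norm_le_of_coeff_zero (N := q * N) hρ₂ hρ₂R hdiff
    (fun m hm => by rw [if_pos hm, sub_self]) hsphere hx₂ρ
  have h2 : (‖x₂‖ / ρ₂) ^ (q * N) = (‖x₁ ^ p * x₂ ^ q‖ / (‖x₁‖ ^ p * ρ₂ ^ q)) ^ N := by
    rw [pow_mul, norm_mul, norm_pow, norm_pow, div_pow, mul_div_mul_left _ _ (by positivity)]
  rw [h2, (hsum x₂ (by rw [mem_ball_zero_iff]; linarith)).unique hF] at h1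
  set t := x₁ ^ p * x₂ ^ q
  set D := ‖x₁‖ ^ p * ρ₂ ^ q with hD
  have hD0 : 0 < D := by positivity
  calc ‖v - F‖ = ‖(v - ∑ n ∈ Finset.range N, t ^ n • g n x₂)
        - (F - ∑ n ∈ Finset.range N, t ^ n • g n x₂)‖ := by congr 1; abel
    _ ≤ C' * A ^ N * (N ! : ℝ) ^ s * ‖t‖ ^ N +
        2 * ((2 * C + 1) * ((2 * (B + 1)) ^ N * (N ! : ℝ) ^ s)) * (‖t‖ / D) ^ N :=
        (norm_sub_le _ _).trans (add_le_add hv h1)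
    _ = C' * A ^ N * (N ! : ℝ) ^ s * ‖t‖ ^ N +
        2 * (2 * C + 1) * (2 * (B + 1) / D) ^ N * (N ! : ℝ) ^ s * ‖t‖ ^ N := by
        rw [div_pow, div_pow]; ring
    _ ≤ C' * (max A (2 * (B + 1) / D)) ^ N * (N ! : ℝ) ^ s * ‖t‖ ^ N +
        2 * (2 * C + 1) * (max A (2 * (B + 1) / D)) ^ N * (N ! : ℝ) ^ s * ‖t‖ ^ N := by
        gcongr
        · exact le_max_left _ _
        · exact le_max_right _ _
    _ = _ := by ring

theorem monomialChart_zero (p q : ℕ) (w : ℂ × ℂ) :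
    monomialChart p q 0 w = (Complex.exp w.1, Complex.exp w.2, p * w.1 + q * w.2) := by
  simp [monomialChart]

theorem exp_monomial (p q : ℕ) (w₁ w₂ : ℂ) :
    Complex.exp (p * w₁ + q * w₂) = Complex.exp w₁ ^ p * Complex.exp w₂ ^ q := by
  rw [Complex.exp_add, Complex.exp_nat_mul, Complex.exp_nat_mul]

theorem mem_monomialSector {p q : ℕ} (hp : 0 < p) (hq : 0 < q) {w₁ w₂ : ℂ} {α β ρ : ℝ}
    (h1 : ‖Complex.exp w₁‖ < ρ) (h2 : ‖Complex.exp w₂‖ < ρ) (h1' : ‖Complex.exp w₁‖ ≤ 1)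
    (h2' : ‖Complex.exp w₂‖ ≤ 1) (hα : α < (p * w₁ + q * w₂).im) (hβ : (p * w₁ + q * w₂).im < β) :
    (Complex.exp w₁, Complex.exp w₂, p * w₁ + q * w₂) ∈ monomialSector p q α β ρ :=
  ⟨exp_monomial p q w₁ w₂, pow_pos (norm_pos_iff.2 (Complex.exp_ne_zero _)) _,
    pow_lt_of_lt_of_le_one (norm_nonneg _) h1 h1' hp,
    pow_pos (norm_pos_iff.2 (Complex.exp_ne_zero _)) _,
    pow_lt_of_lt_of_le_one (norm_nonneg _) h2 h2' hq, hα, hβ⟩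

/-- At points `x₁` where the series converges in `x₂`, its sum is the monomial sum. -/
theorem hasSum_of_hasMonomialGevreyExpansion [CompleteSpace E] {p q : ℕ} (hp : 0 < p) (hq : 0 < q)
    {a : Series₂ E} {l α β r R ρ ρ₂ B C K : ℝ} {f : ℂ × ℂ × ℂ → E} {g : ℕ → ℂ × ℂ → E} {h : ℕ → E}
    {w₁ w₂ : ℂ} (hl : 0 < l) (hαβ : Real.pi / l < β - α)
    (hf : HolomorphicOnMonomialSector p q α β r f) (hR : 0 < R) (hRr : R ≤ r)
    (hg : ∀ n, HasBoundedSum R (block p q a n) (g n))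
    (hest : ∀ a' b' ρ : ℝ, α < a' → a' < b' → b' < β → 0 < ρ → ρ < R →
      ∃ C > 0, ∃ A > 0, ∀ N : ℕ, ∀ z ∈ monomialSector p q a' b' ρ, ‖z.1‖ < R → ‖z.2.1‖ < R →
        ‖f z - ∑ n ∈ Finset.range N, (z.1 ^ p * z.2.1 ^ q) ^ n • g n (z.1, z.2.1)‖
          ≤ C * A ^ N * (N ! : ℝ) ^ (1 / l) * ‖z.1 ^ p * z.2.1 ^ q‖ ^ N)
    (hρ1 : ρ ≤ 1) (hρR : ρ ≤ R / 2) (hB : 0 < B)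
    (hgB : ∀ (n : ℕ) (x₁ x₂ : ℂ) (y : E), x₁ ≠ 0 → x₂ ≠ 0 → ‖x₁‖ < ρ → ‖x₂‖ < ρ →
      HasSum (fun P : ℕ × ℕ => (x₁ ^ P.1 * x₂ ^ P.2) • block p q a n P.1 P.2) y →
        ‖y‖ ≤ B ^ (n + 1) * (n ! : ℝ) ^ (1 / l))
    (hK : 0 < K) (hρ₂ : 0 < ρ₂) (hρ₂ρ : ρ₂ < ρ) (hρ₂K : ρ₂ * K ≤ 1 / 2)
    (hh : ∀ m, HasSum (fun n => Complex.exp w₁ ^ n • a n m) (h m)) (hhC : ∀ m, ‖h m‖ ≤ C * K ^ m)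
    (hw₁ : ‖Complex.exp w₁‖ < ρ) (hw₂ : ‖Complex.exp w₂‖ < ρ₂ / 2)
    (hα : α < (p * w₁ + q * w₂).im) (hβ : (p * w₁ + q * w₂).im < β) :
    HasSum (fun m => Complex.exp w₂ ^ m • h m)
      (f (Complex.exp w₁, Complex.exp w₂, p * w₁ + q * w₂)) := by
  have hq0 : (q : ℂ) ≠ 0 := by exact_mod_cast hq.ne'
  have hx₁0 : 0 < ‖Complex.exp w₁‖ := norm_pos_iff.2 (Complex.exp_ne_zero w₁)
  have hC : 0 ≤ C := (norm_nonneg _).trans (by simpa using hhC 0)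
  set x₁ := Complex.exp w₁ with hx₁
  set t₀ := (p * w₁ + q * w₂ : ℂ) with ht₀
  set rt := (ρ₂ / 2) ^ q * ‖x₁‖ ^ p with hrt
  have hrt0 : 0 < rt := by positivity
  set ε := min (β - α - Real.pi / l) (min (t₀.im - α) (β - t₀.im)) / 3 with hε
  have hm1 := min_le_left (β - α - Real.pi / l) (min (t₀.im - α) (β - t₀.im))
  have hm2 := (min_le_right (β - α - Real.pi / l) (min (t₀.im - α) (β - t₀.im))).trans
    (min_le_left _ _)
  have hm3 := (min_le_right (β - α - Real.pi / l) (min (t₀.im - α) (β - t₀.im))).trans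
    (min_le_right _ _)
  have hε0 : 0 < ε := by
    rw [hε]
    exact div_pos (lt_min (by linarith) (lt_min (by linarith) (by linarith))) (by norm_num)
  have hπl : 0 < Real.pi / l := div_pos Real.pi_pos hl
  obtain ⟨C', hC', A, hA, hCA⟩ := hest (α + ε) (β - ε) (R / 2) (by linarith) (by linarith)
    (by linarith) (half_pos hR) (half_lt_self hR)
  -- With `x₁` fixed, `t` becomes the variable and `x₂ = exp (W t)`. The radius `rt` corresponds to
  -- `‖x₂‖ = ρ₂/2`, so `t` fills a full sector of opening greater than `π/l`.
  let W : ℂ → ℂ := fun t => (t - p * w₁) / q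
  have hWt : ∀ t, p * w₁ + q * W t = t := fun t => by simp only [W]; field_simp; ring
  have hexpW : ∀ t, Complex.exp t = x₁ ^ p * Complex.exp (W t) ^ q := fun t => by
    rw [hx₁, ← exp_monomial, hWt]
  have hWsmall : ∀ t, ‖Complex.exp t‖ < rt ↔ ‖Complex.exp (W t)‖ < ρ₂ / 2 := fun t => by
    rw [hexpW, norm_mul, norm_pow, norm_pow, hrt, mul_comm (_ ^ q), mul_lt_mul_iff_right₀ (by positivity),
      pow_lt_pow_iff_left₀ (norm_nonneg _) (by positivity) hq.ne']
  have hsec : ∀ α' β' t, t ∈ logSector α' β' rt →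
      (x₁, Complex.exp (W t), t) ∈ monomialSector p q α' β' (R / 2) := fun α' β' t ht => by
    have h1 := (hWsmall t).1 (by rw [Complex.norm_exp]; exact ht.1)
    have h2 := mem_monomialSector (w₁ := w₁) (w₂ := W t) (ρ := R / 2) (α := α') (β := β') hp hq
      (by linarith) (by linarith) (by linarith) (by linarith) (by rw [hWt]; exact ht.2.1)
      (by rw [hWt]; exact ht.2.2)
    rwa [hWt] at h2
  have hsum : ∀ y : ℂ, ‖y‖ < ρ₂ → HasSum (fun m => y ^ m • h m) (∑' m, y ^ m • h m) :=
    fun y hy => (summable_pow_smul hK.le hhC (by nlinarith)).hasSum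
  have hsumd : DifferentiableOn ℂ (fun y : ℂ => ∑' m, y ^ m • h m) (Metric.ball 0 ρ₂) :=
    differentiableOn_of_hasSum (c := h) (G := fun y : ℂ => ∑' m, y ^ m • h m) hρ₂ fun y hy => by
      simpa using hsum y (mem_ball_zero_iff.1 hy)
  have hWd : Differentiable ℂ W := by fun_prop
  -- The flatness constant deteriorates as `x₁ → 0`, which is harmless because `x₁` is fixed.
  have hz := eq_zero_of_gevrey_flat (k := l) (r := rt) (a := α + ε) (b := β - ε)
    (f := fun t => f (x₁, Complex.exp (W t), t) - ∑' m, Complex.exp (W t) ^ m • h m)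
    (C := C' + 2 * (2 * C + 1)) (A := max A (2 * (B + 1) / (‖x₁‖ ^ p * ρ₂ ^ q))) hl hrt0
    (by linarith) ?_ (by positivity) (lt_max_of_lt_left hA) ?_ t₀ ?_
  · have hWt₀ : W t₀ = w₂ := by simp only [W, ht₀]; field_simp; ring
    simp only [hWt₀] at hz
    rw [sub_eq_zero] at hz
    rw [hz]
    exact hsum _ (by linarith)
  · refine DifferentiableOn.sub ?_ ?_
    · have h1 := (hf 0).comp (f := fun t => (w₁, W t)) (s := logSector (α + ε) (β - ε) rt)
        ((differentiable_const _).prodMk hWd).differentiableOn fun t ht => by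
          rw [Set.mem_preimage, monomialChart_zero]
          dsimp only
          rw [hWt]
          obtain ⟨e1, e2, e3, e4, e5, e6, e7⟩ := hsec _ _ t ht
          exact ⟨e1, e2, by linarith, e4, by linarith, by linarith, by linarith⟩
      refine h1.congr fun t ht => ?_
      simp only [Function.comp, monomialChart_zero, hWt, hx₁]
    · refine hsumd.comp (Complex.differentiable_exp.comp hWd).differentiableOn fun t ht => ?_
      have h1 := (hWsmall t).1 (by rw [Complex.norm_exp]; exact ht.1)
      rw [mem_ball_zero_iff]
      exact h1.trans (half_lt_self hρ₂)
  · intro N t ht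
    have h1 := (hWsmall t).1 (by rw [Complex.norm_exp]; exact ht.1)
    have hmem : ∀ y : ℂ, ‖y‖ < ρ →
        (x₁, y) ∈ Metric.ball (0 : ℂ) R ×ˢ Metric.ball (0 : ℂ) R := fun y hy =>
      ⟨by rw [mem_ball_zero_iff]; linarith, by rw [mem_ball_zero_iff]; linarith⟩
    have h3 : ‖f (x₁, Complex.exp (W t), t) - ∑ n ∈ Finset.range N,
        (x₁ ^ p * Complex.exp (W t) ^ q) ^ n • g n (x₁, Complex.exp (W t))‖
          ≤ C' * A ^ N * (N ! : ℝ) ^ (1 / l) * ‖x₁ ^ p * Complex.exp (W t) ^ q‖ ^ N :=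
      hCA N (x₁, Complex.exp (W t), t) (hsec _ _ t ht) (by dsimp only; linarith)
        (by dsimp only; linarith)
    have h2 := norm_sub_le_flat hp hq (a := a) (x₁ := x₁) (x₂ := Complex.exp (W t)) (N := N)
      (v := f (x₁, Complex.exp (W t), t)) (F := ∑' m, Complex.exp (W t) ^ m • h m) (h := h)
      (g := fun n y => g n (x₁, y)) (s := 1 / l) (by positivity) (Complex.exp_ne_zero _) hw₁ hρ1
      hρ₂ hρ₂ρ h1.le hB hK hρ₂K hC' hA (fun n y hy => (hg n).2.2 (x₁, y) (hmem y hy))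
      (fun n y hy0 hy => hgB n x₁ y _ (Complex.exp_ne_zero _) hy0 hw₁ hy
        ((hg n).2.2 (x₁, y) (hmem y hy))) hh hhC
      h3 (hsum _ (by linarith))
    rw [hexpW t]
    exact h2
  · refine ⟨?_, by linarith, by linarith⟩
    rw [← Complex.norm_exp, hWsmall]
    have hWt₀ : W t₀ = w₂ := by simp only [W, ht₀]; field_simp; ring
    rwa [hWt₀]

end Identification

/-! ### Propagation around the origin, and the second inclusion. -/

section Propagation

variable {E : Type*} [NormedAddCommGroup E] [NormedSpace ℂ E]

theorem log_div_of_mem_ball {z x : ℂ} (hx : x ∈ Metric.ball z (‖z‖ / 2)) :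
    z ≠ 0 ∧ x ≠ 0 ∧ x / z ∈ Complex.slitPlane ∧ ‖Complex.log (x / z)‖ ≤ 1 ∧
      Complex.exp (Complex.log z + Complex.log (x / z)) = x := by
  have hz : z ≠ 0 := by
    rintro rfl
    simp at hx
  have hz0 : 0 < ‖z‖ := norm_pos_iff.2 hz
  have h1 : ‖x / z - 1‖ < 1 / 2 := by
    rw [div_sub_one hz, norm_div, div_lt_iff₀ hz0, ← dist_eq_norm]
    rw [Metric.mem_ball] at hx
    linarith
  have h2 : x / z ∈ Complex.slitPlane := Complex.ball_one_subset_slitPlane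
    (by rw [Metric.mem_ball, dist_eq_norm]; linarith)
  have hx0 : x ≠ 0 := by
    rintro rfl
    simp at h2
  refine ⟨hz, hx0, h2, ?_, ?_⟩
  · have := Complex.norm_log_one_add_half_le_self h1.le
    rw [add_sub_cancel] at this
    linarith
  · rw [Complex.exp_add, Complex.exp_log hz, Complex.exp_log (div_ne_zero hx0 hz)]
    field_simp

/-- Local bounds `h m = O(K ^ m)` propagate, by means of the monomial sum, to a disk whose radius
is proportional to the distance from the origin. -/
theorem exists_bound_of_monomial [CompleteSpace E] {p q : ℕ} (hp : 0 < p) (hq : 0 < q)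
    {a : Series₂ E} {l α β r R ρ B C K σ : ℝ} {f : ℂ × ℂ × ℂ → E} {g : ℕ → ℂ × ℂ → E}
    {h : ℕ → ℂ → E} {z : ℂ} (hl : 0 < l) (hαβ : Real.pi / l < β - α)
    (hf : HolomorphicOnMonomialSector p q α β r f) (hR : 0 < R) (hRr : R ≤ r)
    (hg : ∀ n, HasBoundedSum R (block p q a n) (g n))
    (hest : ∀ a' b' ρ : ℝ, α < a' → a' < b' → b' < β → 0 < ρ → ρ < R →
      ∃ C > 0, ∃ A > 0, ∀ N : ℕ, ∀ z ∈ monomialSector p q a' b' ρ, ‖z.1‖ < R → ‖z.2.1‖ < R →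
        ‖f z - ∑ n ∈ Finset.range N, (z.1 ^ p * z.2.1 ^ q) ^ n • g n (z.1, z.2.1)‖
          ≤ C * A ^ N * (N ! : ℝ) ^ (1 / l) * ‖z.1 ^ p * z.2.1 ^ q‖ ^ N)
    (hρ : 0 < ρ) (hρ1 : ρ ≤ 1) (hρR : ρ ≤ R / 2) (hB : 0 < B)
    (hgB : ∀ (n : ℕ) (x₁ x₂ : ℂ) (y : E), x₁ ≠ 0 → x₂ ≠ 0 → ‖x₁‖ < ρ → ‖x₂‖ < ρ →
      HasSum (fun P : ℕ × ℕ => (x₁ ^ P.1 * x₂ ^ P.2) • block p q a n P.1 P.2) y →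
        ‖y‖ ≤ B ^ (n + 1) * (n ! : ℝ) ^ (1 / l))
    (hh : ∀ m, ∀ x ∈ Metric.ball (0 : ℂ) ρ, HasSum (fun n => x ^ n • a n m) (h m x))
    (hz : z ≠ 0) (hzρ : ‖z‖ < ρ / 2) (hσ : 0 < σ) (hK : 0 < K)
    (hb : ∀ m, ∀ x ∈ Metric.ball z σ, ‖h m x‖ ≤ C * K ^ m) :
    ∃ C' : ℝ, ∃ K' > 0, ∀ m, ∀ x ∈ Metric.ball z (‖z‖ / 4), ‖h m x‖ ≤ C' * K' ^ m := by
  have hz0 : 0 < ‖z‖ := norm_pos_iff.2 hz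
  have hp0 : (p : ℝ) > 0 := by exact_mod_cast hp
  have hq0 : (q : ℝ) > 0 := by exact_mod_cast hq
  have hqC : (q : ℂ) ≠ 0 := by exact_mod_cast hq.ne'
  have hC : 0 ≤ C := (norm_nonneg _).trans (by simpa using hb 0 z (Metric.mem_ball_self hσ))
  have hsub : Metric.ball z (‖z‖ / 2) ⊆ Metric.ball 0 ρ :=
    Metric.ball_subset_ball' (by rw [dist_zero_right]; linarith)
  -- With `x₂ = s exp (T x)` one has `xᵖ x₂^q = zᵖ s^q`, independent of `x`: moving `x` in the disk
  -- never leaves the sector in the monomial. The series to be extended becomes `∑ exp (T x)ᵐ h m x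
  -- sᵐ`.
  let T : ℂ → ℂ := fun x => -(p / q * Complex.log (x / z))
  set Λ := Real.exp (p / q) with hΛ
  have hΛ0 : 0 < Λ := Real.exp_pos _
  have hTn : ∀ x ∈ Metric.ball z (‖z‖ / 2), ‖T x‖ ≤ p / q := fun x hx => by
    obtain ⟨-, -, -, hlog, -⟩ := log_div_of_mem_ball hx
    simp only [T, norm_neg, norm_mul, norm_div, Complex.norm_natCast]
    exact mul_le_of_le_one_right (by positivity) hlog
  have hexpT : ∀ x ∈ Metric.ball z (‖z‖ / 2), ‖Complex.exp (T x)‖ ≤ Λ := fun x hx =>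
    (Complex.norm_exp_le_exp_norm _).trans (Real.exp_le_exp.2 (hTn x hx))
  have hexpT' : ∀ x ∈ Metric.ball z (‖z‖ / 2), ‖Complex.exp (-T x)‖ ≤ Λ := fun x hx =>
    (Complex.norm_exp_le_exp_norm _).trans (Real.exp_le_exp.2 ((norm_neg _).trans_le (hTn x hx)))
  have hlogd : DifferentiableOn ℂ (fun x => Complex.log (x / z)) (Metric.ball z (‖z‖ / 2)) :=
    fun x hx => ((differentiableAt_id.div_const z).clog
      (log_div_of_mem_ball hx).2.2.1).differentiableWithinAt
  have hTd : DifferentiableOn ℂ T (Metric.ball z (‖z‖ / 2)) := (hlogd.const_mul _).neg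
  have hhd : ∀ m, DifferentiableOn ℂ (h m) (Metric.ball 0 ρ) := fun m =>
    differentiableOn_of_hasSum (z := 0) hρ fun x hx => by simpa using hh m x hx
  have hπl : 0 < Real.pi / l := div_pos Real.pi_pos hl
  set δ := (β - α) / 4 with hδ
  have hδ0 : 0 < δ := by rw [hδ]; linarith
  obtain ⟨M, hM, A, hA, hCA⟩ := hest (α + δ) (β - δ) (R / 2) (by linarith)
    (by linarith) (by linarith) (half_pos hR) (half_lt_self hR)
  obtain ⟨κ, hκ, hκ1, hlog⟩ := exists_log_near (div_pos hδ0 hq0)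
  set ρ₂ := min (ρ / 2) (1 / (2 * K)) with hρ₂
  have hρ₂0 : 0 < ρ₂ := by positivity
  have hρ₂ρ : ρ₂ < ρ := (min_le_left _ _).trans_lt (half_lt_self hρ)
  have hρ₂K : ρ₂ * K ≤ 1 / 2 := by
    calc ρ₂ * K ≤ 1 / (2 * K) * K := by gcongr; exact min_le_right _ _
      _ = 1 / 2 := by field_simp
  set σ' := min σ (‖z‖ / 2) with hσ'
  have hσσ' : Metric.ball z σ' ⊆ Metric.ball z σ := Metric.ball_subset_ball (min_le_left _ _)
  have hσz : Metric.ball z σ' ⊆ Metric.ball z (‖z‖ / 2) :=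
    Metric.ball_subset_ball (min_le_right _ _)
  obtain ⟨C', K', hK', hb'⟩ := exists_bound_of_cross (z := z) (u := ‖z‖ / 2) (σ := σ')
    (h := fun m x => Complex.exp (T x) ^ m • h m x) (C := C) (K := Λ * K) (κ := κ)
    (lt_min hσ (half_pos hz0)) (min_le_right _ _) (by positivity) hκ hκ1
    (fun m => ((hTd.cexp).pow m).smul ((hhd m).mono hsub)) (fun m x hx => by
      rw [norm_smul, norm_pow]
      calc ‖Complex.exp (T x)‖ ^ m * ‖h m x‖ ≤ Λ ^ m * (C * K ^ m) := by
            gcongr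
            · exact hexpT x (hσz hx)
            · exact hb m x (hσσ' hx)
        _ = _ := by rw [mul_pow]; ring)
    (fun ε hε => by
      -- The argument of `s₀` is chosen to make `p arg z + q arg s₀` the bisecting direction of the
      -- sector, so a single monomial sum serves every `z`.
      obtain ⟨v, hvd, hv⟩ := exists_exp_small (((α + β) / 2 - p * (Complex.log z).im) / q)
        (ε := min ε (ρ₂ / 2 / (2 * Λ))) (by positivity)
      have hvΛ : 2 * ‖Complex.exp v‖ * Λ < ρ₂ / 2 := by
        have := hv.trans_le (min_le_right _ _)
        rw [lt_div_iff₀ (by positivity)] at this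
        linarith
      refine ⟨Complex.exp v, norm_pos_iff.2 (Complex.exp_ne_zero v),
        hv.trans_le (min_le_left _ _), M, fun x s => (f ∘ monomialChart p q 0)
          (Complex.log z + Complex.log (x / z), v + Complex.log (s / Complex.exp v) + T x),
        fun s hs => ?_⟩
      obtain ⟨hs0, -, hlogs, hexp⟩ := hlog v s hs
      set w := v + Complex.log (s / Complex.exp v) with hw
      have hwim := im_mem_of_norm_lt hvd hlogs
      have ht : ∀ x, (p * (Complex.log z + Complex.log (x / z)) + q * (w + T x) : ℂ)
          = p * Complex.log z + q * w := fun x => by simp only [T]; field_simp; ring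
      have htim : (p * Complex.log z + q * w : ℂ).im = p * (Complex.log z).im + q * w.im := by
        simp
      have h1 : α + δ < (p * Complex.log z + q * w : ℂ).im := by
        rw [htim]
        have := mul_lt_mul_of_pos_left hwim.1 hq0
        rw [← sub_div, mul_div_cancel₀ _ hq0.ne'] at this
        linarith
      have h2 : (p * Complex.log z + q * w : ℂ).im < β - δ := by
        rw [htim]
        have := mul_lt_mul_of_pos_left hwim.2 hq0
        rw [← add_div, mul_div_cancel₀ _ hq0.ne'] at this
        linarith
      have hx₁ : ∀ x ∈ Metric.ball z (‖z‖ / 2),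
          Complex.exp (Complex.log z + Complex.log (x / z)) = x := fun x hx =>
        (log_div_of_mem_ball hx).2.2.2.2
      have hx₁n : ∀ x ∈ Metric.ball z (‖z‖ / 2), ‖x‖ < ρ := fun x hx =>
        mem_ball_zero_iff.1 (hsub hx)
      have hx₂ : ∀ x ∈ Metric.ball z (‖z‖ / 2), ‖Complex.exp (w + T x)‖ < ρ₂ / 2 := fun x hx => by
        rw [Complex.exp_add, hexp, norm_mul]
        refine lt_of_le_of_lt ?_ hvΛ
        gcongr
        · exact (norm_lt_of_mem_ball hκ1 hs).le
        · exact hexpT x hx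
      have hmem : ∀ x ∈ Metric.ball z (‖z‖ / 2),
          monomialChart p q 0 (Complex.log z + Complex.log (x / z), w + T x) ∈
            monomialSector p q (α + δ) (β - δ) (R / 2) := fun x hx => by
        rw [monomialChart_zero]
        have e1 := hx₁n x hx
        have e2 := hx₂ x hx
        exact mem_monomialSector hp hq (by rw [hx₁ x hx]; linarith) (by linarith)
          (by rw [hx₁ x hx]; linarith) (by linarith) (by rw [ht]; exact h1) (by rw [ht]; exact h2)
      refine ⟨?_, fun x hx => ?_, fun x hx => ?_⟩
      · refine (hf 0).comp ((hlogd.const_add _).prodMk (hTd.const_add _)) fun x hx => ?_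
        obtain ⟨e1, e2, e3, e4, e5, e6, e7⟩ := hmem x hx
        exact ⟨e1, e2, by linarith, e4, by linarith, by linarith, by linarith⟩
      · have e1 := hx₁n x hx
        have e2 := hx₂ x hx
        have := hCA 0 _ (hmem x hx) (by rw [monomialChart_zero]; dsimp only; rw [hx₁ x hx]; linarith)
          (by rw [monomialChart_zero]; dsimp only; linarith)
        simpa using this
      · have hxz := hσz hx
        have := hasSum_of_hasMonomialGevreyExpansion hp hq (a := a) (h := fun m => h m x)
          (w₁ := Complex.log z + Complex.log (x / z)) (w₂ := w + T x) (C := C) hl hαβ hf hR hRr hg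
          hest hρ1 hρR hB hgB hK hρ₂0 hρ₂ρ hρ₂K
          (fun m => by rw [hx₁ x hxz]; exact hh m x (hsub hxz)) (fun m => hb m x (hσσ' hx))
          (by rw [hx₁ x hxz]; exact hx₁n x hxz) (hx₂ x hxz) (by rw [ht]; linarith)
          (by rw [ht]; linarith)
        simp only [Function.comp, monomialChart_zero]
        convert this using 1
        funext m
        rw [Complex.exp_add w, hexp, mul_pow, smul_smul])
    (u' := ‖z‖ / 4) (by linarith)
  refine ⟨C', Λ * K', by positivity, fun m x hx => ?_⟩
  have hxz : x ∈ Metric.ball z (‖z‖ / 2) := Metric.ball_subset_ball (by linarith) hx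
  have h1 := hb' m x hx
  calc ‖h m x‖ = ‖Complex.exp (-T x)‖ ^ m * ‖Complex.exp (T x) ^ m • h m x‖ := by
        rw [norm_smul, norm_pow, ← mul_assoc, ← mul_pow, ← norm_mul, ← Complex.exp_add]
        simp
    _ ≤ Λ ^ m * (C' * K' ^ m) := by
        gcongr
        exact hexpT' x hxz
    _ = _ := by rw [mul_pow]; ring

/-- The points with a local bound `‖h m‖ ≤ C Kᵐ` form an open set meeting a small circle around the
origin; `exists_bound_of_monomial` makes it relatively closed there, so it contains the circle, and
compactness gives uniform constants. -/
theorem convergent_of_summableInMonomial [CompleteSpace E] {p q : ℕ} (hp : 0 < p) (hq : 0 < q)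
    {a : Series₂ E} {k l r : ℝ} (hk : 0 < k) (hl : 0 < l) (hr : 0 < r)
    (h0 : a ∈ summableInVariable E 0 r k) (h1 : a ∈ summableInMonomial E p q l) :
    a ∈ convergentSeries E := by
  obtain ⟨ρ₁, hρ₁, B, hB, hgB⟩ := exists_block_bound hp hq hl h1
  obtain ⟨⟨R₀, hR₀, hexp⟩, S, hS, hdir⟩ := h1
  obtain ⟨c, hc, hcS⟩ := h0
  obtain ⟨d₁, hd₁⟩ := hcS.exists_direction
  obtain ⟨d, -, hd⟩ := exists_angle_notMem hS 0 one_pos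
  obtain ⟨α, β, r', hr', hαβ, -, f, hf, R, hR, hRr, g, hg, hest⟩ := hdir d hd
  obtain ⟨c', hc'⟩ := hexp 1
  choose h hhd hh using fun m => (c' m).2
  have hhs : ∀ m, ∀ x ∈ Metric.ball (0 : ℂ) R₀, HasSum (fun n => x ^ n • a n m) (h m x) :=
    fun m x hx => by simpa [hh, slice] using hc' m ⟨x, hx⟩
  set ρ := min (min ρ₁ R₀) (min 1 (R / 2)) with hρdef
  have hρ : 0 < ρ := by positivity
  have hρρ₁ : ρ ≤ ρ₁ := (min_le_left _ _).trans (min_le_left _ _)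
  have hρR₀ : ρ ≤ R₀ := (min_le_left _ _).trans (min_le_right _ _)
  have hρ1 : ρ ≤ 1 := (min_le_right _ _).trans (min_le_left _ _)
  have hρR : ρ ≤ R / 2 := (min_le_right _ _).trans (min_le_right _ _)
  obtain ⟨z₀, hz₀, hz₀ρ, hU₀⟩ := exists_geometric_bound_of_isSummableInDirection hr hk hR₀ hc hd₁
    hhs (half_pos hρ)
  set τ := ‖z₀‖ with hτ
  have hτ0 : 0 < τ := norm_pos_iff.2 hz₀
  let U : Set ℂ := {z | ∃ σ > 0, ∃ C : ℝ, ∃ K > 0, ∀ m, ∀ x ∈ Metric.ball z σ,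
    ‖h m x‖ ≤ C * K ^ m}
  have hUopen : IsOpen U := by
    refine Metric.isOpen_iff.2 fun z ⟨σ, hσ, C, K, hK, hb⟩ => ⟨σ / 2, half_pos hσ, fun y hy => ?_⟩
    rw [Metric.mem_ball] at hy
    exact ⟨σ / 2, half_pos hσ, C, K, hK, fun m x hx =>
      hb m x (Metric.ball_subset_ball' (by linarith) hx)⟩
  have hsphere : Metric.sphere (0 : ℂ) τ ⊆ U := by
    refine (isPreconnected_sphere (by simp) 0 τ).subset_of_closure_inter_subset hUopen
      ⟨z₀, by simp [hτ], hU₀⟩ ?_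
    rintro x ⟨hxU, hx⟩
    rw [mem_sphere_zero_iff_norm] at hx
    -- Within `τ/10` of `x` one has `‖z‖ > 9τ/10`, so the disk of radius `‖z‖/4` about `z` contains
    -- `x`; the other bound keeps `‖z‖ < ρ/2`.
    obtain ⟨z, ⟨σ, hσ, C, K, hK, hb⟩, hxz⟩ := Metric.mem_closure_iff.1 hxU
      (min (τ / 10) (ρ / 2 - τ)) (lt_min (by linarith) (by linarith))
    have e1 := hxz.trans_le (min_le_left _ _)
    have e2 := hxz.trans_le (min_le_right _ _)
    rw [dist_eq_norm] at e1 e2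
    have e3 : ‖x‖ ≤ ‖z‖ + ‖x - z‖ := norm_le_norm_add_norm_sub' x z
    have e4 : ‖z‖ ≤ ‖x‖ + ‖x - z‖ := norm_le_norm_add_norm_sub x z
    have hz : z ≠ 0 := norm_pos_iff.1 (by linarith)
    obtain ⟨C', K', hK', hb'⟩ := exists_bound_of_monomial hp hq hl hαβ hf hR hRr hg hest hρ hρ1 hρR
      hB (fun n x₁ x₂ y n1 n2 l1 l2 => hgB n x₁ x₂ y n1 n2 (l1.trans_le hρρ₁) (l2.trans_le hρρ₁))
      (fun m x hx => hhs m x (Metric.ball_subset_ball hρR₀ hx)) hz (by linarith) hσ hK hb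
    exact ⟨‖z‖ / 4 - ‖x - z‖, by linarith, C', K', hK', fun m y hy =>
      hb' m y (Metric.ball_subset_ball' (by rw [dist_eq_norm]; linarith) hy)⟩
  have hQ : ∃ C : ℝ, 0 ≤ C ∧ ∃ K > 0, ∀ m, ∀ x ∈ Metric.sphere (0 : ℂ) τ,
      ‖h m x‖ ≤ C * K ^ m := by
    refine (isCompact_sphere (0 : ℂ) τ).induction_on
      (p := fun s => ∃ C : ℝ, 0 ≤ C ∧ ∃ K > 0, ∀ m, ∀ x ∈ s, ‖h m x‖ ≤ C * K ^ m) ?_ ?_ ?_ ?_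
    · exact ⟨0, le_rfl, 1, one_pos, fun m x hx => hx.elim⟩
    · rintro s s' hss' ⟨C, hC, K, hK, hb⟩
      exact ⟨C, hC, K, hK, fun m x hx => hb m x (hss' hx)⟩
    · rintro s s' ⟨C, hC, K, hK, hb⟩ ⟨C', hC', K', hK', hb'⟩
      refine ⟨max C C', le_max_of_le_left hC, max K K', lt_max_of_lt_left hK, fun m x hx => ?_⟩
      rcases hx with hx | hx
      · refine (hb m x hx).trans ?_
        gcongr
        · exact le_max_left _ _
        · exact le_max_left _ _
      · refine (hb' m x hx).trans ?_
        gcongr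
        · exact le_max_right _ _
        · exact le_max_right _ _
    · intro x hx
      obtain ⟨σ, hσ, C, K, hK, hb⟩ := hsphere hx
      exact ⟨Metric.ball x σ, mem_nhdsWithin_of_mem_nhds (Metric.ball_mem_nhds x hσ), C,
        (norm_nonneg _).trans (by simpa using hb 0 x (Metric.mem_ball_self hσ)), K, hK, hb⟩
  obtain ⟨C, -, K, hK, hb⟩ := hQ
  exact mem_convergentSeries_of_sphere hK hτ0 (by linarith) hhs hb

end Propagation

/-! ### Exchanging the variables, to deduce the case of `x₂`. -/

section Transpose

variable {E : Type*} [NormedAddCommGroup E] [NormedSpace ℂ E]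

theorem mem_summableInVariable_transpose {a : Series₂ E} {r k : ℝ} :
    (fun n m => a m n) ∈ summableInVariable E 0 r k ↔ a ∈ summableInVariable E 1 r k :=
  Iff.rfl

theorem mem_convergentSeries_transpose {a : Series₂ E}
    (h : (fun n m => a m n) ∈ convergentSeries E) : a ∈ convergentSeries E := by
  obtain ⟨r, hr, h⟩ := h
  refine ⟨r, hr, fun x₁ hx₁ x₂ hx₂ => ?_⟩
  have := (Equiv.summable_iff (Equiv.prodComm ℕ ℕ)
    (f := fun n : ℕ × ℕ => (x₂ ^ n.1 * x₁ ^ n.2) • a n.2 n.1)).2 (h x₂ hx₂ x₁ hx₁)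
  refine this.congr fun P => ?_
  simp [mul_comm]

theorem monomialSector_swap {p q : ℕ} {α β r : ℝ} {z : ℂ × ℂ × ℂ} :
    (z.2.1, z.1, z.2.2) ∈ monomialSector p q α β r ↔ z ∈ monomialSector q p α β r := by
  simp only [monomialSector, Set.mem_ofPred_eq]
  rw [mul_comm (z.2.1 ^ p)]
  tauto

theorem monomialChart_swap (p q : ℕ) (ν : ℤ) (w : ℂ × ℂ) :
    monomialChart p q ν w.swap = ((monomialChart q p ν w).2.1, (monomialChart q p ν w).1,
      (monomialChart q p ν w).2.2) := by
  simp [monomialChart, add_comm]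

omit [NormedSpace ℂ E] in
theorem block_transpose (p q : ℕ) (a : Series₂ E) (n m j : ℕ) :
    block q p (fun n m => a m n) n m j = block p q a n j m := by
  simp only [block, or_comm]

theorem HasBoundedSum.transpose {R : ℝ} {a : Series₂ E} {g : ℂ × ℂ → E} (h : HasBoundedSum R a g) :
    HasBoundedSum R (fun n m => a m n) (g ∘ Prod.swap) := by
  obtain ⟨h1, ⟨M, h2⟩, h3⟩ := h
  refine ⟨h1.comp (differentiable_snd.prodMk differentiable_fst).differentiableOn fun x hx => ⟨hx.2, hx.1⟩,
    ⟨M, fun x hx => h2 _ ⟨hx.2, hx.1⟩⟩, fun x hx => ?_⟩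
  have := (Equiv.hasSum_iff (Equiv.prodComm ℕ ℕ)
    (f := fun n : ℕ × ℕ => (x.2 ^ n.1 * x.1 ^ n.2) • a n.1 n.2)).2 (h3 x.swap ⟨hx.2, hx.1⟩)
  have h4 : (fun n : ℕ × ℕ => (x.1 ^ n.1 * x.2 ^ n.2) • a n.2 n.1) =
      (fun n : ℕ × ℕ => (x.2 ^ n.1 * x.1 ^ n.2) • a n.1 n.2) ∘ Equiv.prodComm ℕ ℕ := by
    funext P
    simp [mul_comm]
  exact h4 ▸ this

/-- Swapping `x₁` with `x₂` and `p` with `q` preserves the monomial, hence also the chosen logarithm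
`t`, the blocks and the estimates. -/
theorem mem_summableInMonomial_transpose {a : Series₂ E} {p q : ℕ} {l : ℝ}
    (h : a ∈ summableInMonomial E p q l) :
    (fun n m => a m n) ∈ summableInMonomial E q p l := by
  obtain ⟨⟨r, hr, hC⟩, S, hS, hd⟩ := h
  refine ⟨⟨r, hr, fun j => ?_⟩, S, hS, fun d hdS => ?_⟩
  · fin_cases j
    · exact hC 1
    · exact hC 0
  · obtain ⟨α, β, r, hr, hαβ, hαβd, f, hf, R, hR, hRr, g, hg, hest⟩ := hd d hdS
    refine ⟨α, β, r, hr, hαβ, hαβd, fun z => f (z.2.1, z.1, z.2.2), fun ν => ?_, R, hR, hRr,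
      fun n => g n ∘ Prod.swap, fun n => ?_, fun a' b' ρ h1 h2 h3 h4 h5 => ?_⟩
    · have := (hf ν).comp (f := Prod.swap)
        (s := monomialChart q p ν ⁻¹' monomialSector q p α β r)
        (differentiable_snd.prodMk differentiable_fst).differentiableOn fun w hw => by
          rw [Set.mem_preimage, monomialChart_swap]
          exact monomialSector_swap.2 hw
      refine this.congr fun w _ => ?_
      simp only [Function.comp, monomialChart_swap]
    · have := (hg n).transpose
      convert this using 1
      funext m j
      exact block_transpose p q a n m j
    · obtain ⟨C, hC, A, hA, hCA⟩ := hest a' b' ρ h1 h2 h3 h4 h5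
      refine ⟨C, hC, A, hA, fun N z hz hz1 hz2 => ?_⟩
      have := hCA N (z.2.1, z.1, z.2.2) (monomialSector_swap.2 hz) hz2 hz1
      simpa only [mul_comm (z.2.1 ^ p), Function.comp, Prod.swap_prod_mk] using this

end Transpose

/-! ### Convergent series are summable in every sense. -/

section Convergent

variable {E : Type*} [NormedAddCommGroup E] [NormedSpace ℂ E]

/-- Weierstrass: uniform limits of holomorphic maps are holomorphic. Completeness is what lets
`isKSummable_of_bound` sum series with coefficients in `Ob r E`. -/
instance Ob.completeSpace [CompleteSpace E] (r : ℝ) : CompleteSpace (Ob r E) := by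
  classical
  have hcl : IsClosed (Ob r E : Set (Metric.ball (0 : ℂ) r →ᵇ E)) := by
    refine IsSeqClosed.isClosed fun g g₀ hg hlim => ?_
    choose G hGd hG using hg
    let G₀ : ℂ → E := fun x => if h : x ∈ Metric.ball (0 : ℂ) r then g₀ ⟨x, h⟩ else 0
    have hG₀ : ∀ x : Metric.ball (0 : ℂ) r, g₀ x = G₀ x := fun x => by
      simp only [G₀]
      rw [dif_pos x.2]
    refine ⟨G₀, ?_, hG₀⟩
    have hu : TendstoUniformlyOn G G₀ Filter.atTop (Metric.ball 0 r) := by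
      have := BoundedContinuousFunction.tendsto_iff_tendstoUniformly.1 hlim
      rw [Metric.tendstoUniformly_iff] at this
      rw [Metric.tendstoUniformlyOn_iff]
      intro ε hε
      filter_upwards [this ε hε] with n hn x hx
      simpa [hG₀, hG] using hn ⟨x, hx⟩
    exact hu.tendstoLocallyUniformlyOn.differentiableOn (.of_forall hGd) Metric.isOpen_ball
  exact hcl.completeSpace_coe

theorem exists_bound_of_mem_convergentSeries {a : Series₂ E} (h : a ∈ convergentSeries E) :
    ∃ C : ℝ, ∃ A > 0, ∀ n m, ‖a n m‖ ≤ C * A ^ n * A ^ m := by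
  obtain ⟨r, hr, h⟩ := h
  have hmem : ((r / 2 : ℝ) : ℂ) ∈ Metric.ball (0 : ℂ) r := by
    rw [mem_ball_zero_iff, Complex.norm_of_nonneg (by positivity)]
    linarith
  obtain ⟨C, hC⟩ := (h _ hmem _ hmem).tendsto_cofinite_zero.norm.bddAbove_range_of_cofinite
  refine ⟨C, (r / 2)⁻¹, by positivity, fun n m => ?_⟩
  have : ‖(((r / 2 : ℝ) : ℂ) ^ n * ((r / 2 : ℝ) : ℂ) ^ m) • a n m‖ ≤ C := hC ⟨(n, m), rfl⟩
  rw [norm_smul, norm_mul, norm_pow, norm_pow, Complex.norm_of_nonneg (by positivity)] at this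
  rw [inv_pow, inv_pow, ← div_eq_mul_inv, ← div_eq_mul_inv, div_div, le_div_iff₀ (by positivity)]
  linarith

theorem exists_mem_Ob_of_bound [CompleteSpace E] {b : ℕ → E} {C A r : ℝ} (hr : 0 < r) (hA : 0 < A)
    (hrA : r * A ≤ 1 / 2) (hb : ∀ m, ‖b m‖ ≤ C * A ^ m) :
    ∃ g : Ob r E, (∀ x : Metric.ball (0 : ℂ) r, HasSum (fun m => (x : ℂ) ^ m • b m) (g.1 x)) ∧
      ‖g‖ ≤ 2 * C := by
  have hC : 0 ≤ C := (norm_nonneg _).trans (by simpa using hb 0)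
  let G : ℂ → E := fun x => ∑' m, x ^ m • b m
  have hxA : ∀ x ∈ Metric.ball (0 : ℂ) r, ‖x‖ * A ≤ 1 / 2 := fun x hx => by
    rw [mem_ball_zero_iff] at hx
    nlinarith
  have hsum : ∀ x ∈ Metric.ball (0 : ℂ) r, HasSum (fun m => x ^ m • b m) (G x) := fun x hx =>
    (summable_pow_smul hA.le hb ((hxA x hx).trans_lt (by norm_num))).hasSum
  have hd : DifferentiableOn ℂ G (Metric.ball 0 r) :=
    differentiableOn_of_hasSum (c := b) hr fun x hx => by simpa using hsum x hx
  have hbd : ∀ x : Metric.ball (0 : ℂ) r, ‖G x‖ ≤ 2 * C := fun x => by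
    have := norm_sub_sum_range_le hA.le hb (hxA x x.2) (by norm_num) (hsum x x.2) 0
    simp only [Finset.range_zero, Finset.sum_empty, sub_zero, pow_zero, mul_one] at this
    linarith
  let g : Metric.ball (0 : ℂ) r →ᵇ E := BoundedContinuousFunction.ofNormedAddCommGroup
    (fun x => G x) hd.continuousOn.domRestrict (2 * C) hbd
  exact ⟨⟨g, G, hd, fun _ => rfl⟩, fun x => hsum x x.2,
    BoundedContinuousFunction.norm_ofNormedAddCommGroup_le _ (by positivity) hbd⟩

/-- The sum itself is the asymptotic function on a sector of opening `2π/k`, with geometric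
remainders and no exceptional direction. -/
theorem isKSummable_of_bound [CompleteSpace E] {c : ℕ → E} {C A k : ℝ} (hk : 0 < k) (hA : 0 < A)
    (hc : ∀ n, ‖c n‖ ≤ C * A ^ n) : IsKSummable k c := by
  have hC : 0 ≤ C := (norm_nonneg _).trans (by simpa using hc 0)
  have hπk : 0 < Real.pi / k := div_pos Real.pi_pos hk
  have hrA : 1 / (2 * A) * A = 1 / 2 := by field_simp
  refine ⟨∅, Set.finite_empty, fun d _ => ⟨d - Real.pi / k, d + Real.pi / k, 1 / (2 * A),
    by positivity, by linarith, by ring, fun w => ∑' n, Complex.exp w ^ n • c n,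
    differentiableOn_tsum_exp hA.le hc (by positivity) (by rw [hrA]; norm_num), ?_⟩⟩
  refine fun a' b' r' _ _ _ _ hr' => ⟨2 * C + 1, by positivity, A, hA, fun N w hw => ?_⟩
  have hx : ‖Complex.exp w‖ * A ≤ 1 / 2 := by
    rw [Complex.norm_exp, ← hrA]
    gcongr
    exact (hw.1.trans hr').le
  have h1 := norm_sub_sum_range_le hA.le hc hx (by norm_num)
    (summable_pow_smul hA.le hc (hx.trans_lt (by norm_num))).hasSum N
  refine h1.trans ?_
  calc C * (1 - 1 / 2)⁻¹ * A ^ N * ‖Complex.exp w‖ ^ N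
      = (2 * C) * A ^ N * 1 * ‖Complex.exp w‖ ^ N := by ring
    _ ≤ (2 * C + 1) * A ^ N * (N ! : ℝ) ^ (1 / k) * ‖Complex.exp w‖ ^ N := by
        gcongr
        · linarith
        · exact one_le_factorial_rpow N (by positivity)

omit [NormedSpace ℂ E] in
theorem norm_slice_le {a : Series₂ E} {C A : ℝ} (h : ∀ n m, ‖a n m‖ ≤ C * A ^ n * A ^ m)
    (j : Fin 2) (n m : ℕ) : ‖slice j a n m‖ ≤ C * A ^ n * A ^ m := by
  unfold slice
  split_ifs
  · exact h n m
  · exact (h m n).trans_eq (by ring)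

theorem exists_isExpansionIn_of_bound [CompleteSpace E] {a : Series₂ E} {C A r : ℝ} (hr : 0 < r)
    (hA : 0 < A) (hrA : r * A ≤ 1 / 2) (h : ∀ n m, ‖a n m‖ ≤ C * A ^ n * A ^ m) (j : Fin 2) :
    ∃ c : ℕ → Ob r E, IsExpansionIn j r a c ∧ ∀ n, ‖c n‖ ≤ (2 * C) * A ^ n := by
  choose c hc hcb using fun n => exists_mem_Ob_of_bound hr hA hrA (norm_slice_le h j n)
  exact ⟨c, hc, fun n => (hcb n).trans_eq (by ring)⟩

theorem mem_summableInVariable_of_bound [CompleteSpace E] {a : Series₂ E} {C A r k : ℝ} (hk : 0 < k)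
    (hr : 0 < r) (hA : 0 < A) (hrA : r * A ≤ 1 / 2) (h : ∀ n m, ‖a n m‖ ≤ C * A ^ n * A ^ m)
    (j : Fin 2) : a ∈ summableInVariable E j r k := by
  obtain ⟨c, hc, hcb⟩ := exists_isExpansionIn_of_bound hr hA hrA h j
  exact ⟨c, hc, isKSummable_of_bound hk hA hcb⟩

theorem summable_half_mul_half (C : ℝ) :
    HasSum (fun P : ℕ × ℕ => C * ((1 / 2 : ℝ) ^ P.1 * (1 / 2 : ℝ) ^ P.2)) (4 * C) := by
  have h1 : HasSum (fun n : ℕ => (1 / 2 : ℝ) ^ n) 2 := hasSum_geometric_two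
  have h2 := (h1.mul h1 (summable_geometric_two.mul_of_nonneg summable_geometric_two
    (fun _ => by positivity) (fun _ => by positivity))).mul_left C
  rwa [show C * (2 * 2) = 4 * C by ring] at h2

theorem norm_term_two_le {b : Series₂ E} {C A : ℝ} (hA : 0 < A) {x₁ x₂ : ℂ}
    (hb : ∀ n m, ‖b n m‖ ≤ C * A ^ n * A ^ m) (h1 : ‖x₁‖ * A ≤ 1 / 2) (h2 : ‖x₂‖ * A ≤ 1 / 2)
    (P : ℕ × ℕ) : ‖(x₁ ^ P.1 * x₂ ^ P.2) • b P.1 P.2‖ ≤ C * ((1 / 2) ^ P.1 * (1 / 2) ^ P.2) := by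
  have hC : 0 ≤ C := (norm_nonneg _).trans (by simpa using hb 0 0)
  rw [norm_smul, norm_mul, norm_pow, norm_pow]
  calc ‖x₁‖ ^ P.1 * ‖x₂‖ ^ P.2 * ‖b P.1 P.2‖
      ≤ ‖x₁‖ ^ P.1 * ‖x₂‖ ^ P.2 * (C * A ^ P.1 * A ^ P.2) := by gcongr; exact hb _ _
    _ = C * ((‖x₁‖ * A) ^ P.1 * (‖x₂‖ * A) ^ P.2) := by rw [mul_pow, mul_pow]; ring
    _ ≤ _ := by gcongr

/-- For termwise derivatives: the factor `n` is absorbed by `2ⁿ`, which is why radii satisfy `x A ≤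
1/4` instead of `1/2`. -/
theorem natCast_mul_pow_le {A x : ℝ} (hA : 0 < A) (hx : 0 ≤ x) (hxA : x * A ≤ 1 / 4) (n : ℕ) :
    n * x ^ (n - 1) * A ^ n ≤ 4 * A * (1 / 2) ^ n := by
  rcases n with _ | n
  · simp; positivity
  · have h1 : ((n + 1 : ℕ) : ℝ) ≤ 2 ^ (n + 1) := by exact_mod_cast (n + 1).lt_two_pow_self.le
    calc ((n + 1 : ℕ) : ℝ) * x ^ (n + 1 - 1) * A ^ (n + 1)
        = ((n + 1 : ℕ) : ℝ) * (x * A) ^ n * A := by rw [Nat.add_sub_cancel, mul_pow]; ring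
      _ ≤ 2 ^ (n + 1) * (1 / 4) ^ n * A := by gcongr
      _ = 4 * A * (1 / 2) ^ (n + 1) := by
          rw [show (1 / 4 : ℝ) = 1 / 2 * (1 / 2) by norm_num, mul_pow, pow_succ, pow_succ]
          have : (2 : ℝ) ^ n * (1 / 2) ^ n = 1 := by rw [← mul_pow]; norm_num
          linear_combination (2 * A * (1 / 2) ^ n) * this

theorem hasBoundedSum_of_bound [CompleteSpace E] {b : Series₂ E} {C A R : ℝ}
    (hA : 0 < A) (hRA : R * A ≤ 1 / 4) (hb : ∀ n m, ‖b n m‖ ≤ C * A ^ n * A ^ m) :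
    HasBoundedSum R b (fun x => ∑' P : ℕ × ℕ, (x.1 ^ P.1 * x.2 ^ P.2) • b P.1 P.2) := by
  have hC : 0 ≤ C := (norm_nonneg _).trans (by simpa using hb 0 0)
  have hxA : ∀ x ∈ Metric.ball (0 : ℂ) R, ‖x‖ * A ≤ 1 / 4 := fun x hx => by
    rw [mem_ball_zero_iff] at hx
    nlinarith
  have hterm : ∀ x ∈ Metric.ball (0 : ℂ) R ×ˢ Metric.ball (0 : ℂ) R, ∀ P : ℕ × ℕ,
      ‖(x.1 ^ P.1 * x.2 ^ P.2) • b P.1 P.2‖ ≤ C * ((1 / 2) ^ P.1 * (1 / 2) ^ P.2) := fun x hx =>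
    norm_term_two_le hA hb ((hxA _ hx.1).trans (by norm_num)) ((hxA _ hx.2).trans (by norm_num))
  have hsum : ∀ x ∈ Metric.ball (0 : ℂ) R ×ˢ Metric.ball (0 : ℂ) R,
      Summable fun P : ℕ × ℕ => (x.1 ^ P.1 * x.2 ^ P.2) • b P.1 P.2 := fun x hx =>
    .of_norm_bounded (summable_half_mul_half C).summable (hterm x hx)
  refine ⟨fun x hx => ?_, ⟨4 * C, fun x hx => tsum_of_norm_bounded (summable_half_mul_half C)
    (hterm x hx)⟩, fun x hx => (hsum x hx).hasSum⟩
  refine (hasFDerivAt_tsum_of_isPreconnected (𝕜 := ℂ)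
    (u := fun P : ℕ × ℕ => (8 * A * C) * ((1 / 2 : ℝ) ^ P.1 * (1 / 2 : ℝ) ^ P.2))
    (f := fun P (x : ℂ × ℂ) => (x.1 ^ P.1 * x.2 ^ P.2) • b P.1 P.2)
    (f' := fun P x => (x.1 ^ P.1 • ((P.2 : ℂ) * x.2 ^ (P.2 - 1)) • ContinuousLinearMap.snd ℂ ℂ ℂ +
      x.2 ^ P.2 • ((P.1 : ℂ) * x.1 ^ (P.1 - 1)) • ContinuousLinearMap.fst ℂ ℂ ℂ).smulRight
        (b P.1 P.2)) (summable_half_mul_half _).summable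
    (Metric.isOpen_ball.prod Metric.isOpen_ball)
    ((convex_ball (0 : ℂ) R).prod (convex_ball (0 : ℂ) R)).isPreconnected
    (fun P x _ => ?_) (fun P x hx => ?_) hx (hsum x hx) hx).differentiableAt.differentiableWithinAt
  · have h1 : HasFDerivAt (fun x : ℂ × ℂ => x.1 ^ P.1)
        (((P.1 : ℂ) * x.1 ^ (P.1 - 1)) • ContinuousLinearMap.fst ℂ ℂ ℂ) x :=
      (hasDerivAt_pow P.1 x.1).comp_hasFDerivAt x hasFDerivAt_fst
    have h2 : HasFDerivAt (fun x : ℂ × ℂ => x.2 ^ P.2)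
        (((P.2 : ℂ) * x.2 ^ (P.2 - 1)) • ContinuousLinearMap.snd ℂ ℂ ℂ) x :=
      (hasDerivAt_pow P.2 x.2).comp_hasFDerivAt x hasFDerivAt_snd
    exact (h1.mul h2).smul_const _
  · rw [ContinuousLinearMap.norm_smulRight_apply]
    have e1 := hxA _ hx.1
    have e2 := hxA _ hx.2
    set y₁ := ‖x.1‖
    set y₂ := ‖x.2‖
    have hy₁ : 0 ≤ y₁ := norm_nonneg _
    have hy₂ : 0 ≤ y₂ := norm_nonneg _
    have h1 : ‖x.1 ^ P.1 • ((P.2 : ℂ) * x.2 ^ (P.2 - 1)) • ContinuousLinearMap.snd ℂ ℂ ℂ +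
        x.2 ^ P.2 • ((P.1 : ℂ) * x.1 ^ (P.1 - 1)) • ContinuousLinearMap.fst ℂ ℂ ℂ‖ ≤
        y₁ ^ P.1 * (P.2 * y₂ ^ (P.2 - 1)) + y₂ ^ P.2 * (P.1 * y₁ ^ (P.1 - 1)) := by
      refine (norm_add_le _ _).trans (add_le_add ?_ ?_)
      · rw [norm_smul, norm_smul, norm_pow, norm_mul, norm_pow, Complex.norm_natCast, ← mul_assoc]
        exact mul_le_of_le_one_right (by positivity) (ContinuousLinearMap.norm_snd_le ..)
      · rw [norm_smul, norm_smul, norm_pow, norm_mul, norm_pow, Complex.norm_natCast, ← mul_assoc]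
        exact mul_le_of_le_one_right (by positivity) (ContinuousLinearMap.norm_fst_le ..)
    calc _ ≤ (y₁ ^ P.1 * (P.2 * y₂ ^ (P.2 - 1)) + y₂ ^ P.2 * (P.1 * y₁ ^ (P.1 - 1))) *
          (C * A ^ P.1 * A ^ P.2) := by gcongr; exact hb _ _
      _ = C * ((y₁ * A) ^ P.1 * (P.2 * y₂ ^ (P.2 - 1) * A ^ P.2) +
          (y₂ * A) ^ P.2 * (P.1 * y₁ ^ (P.1 - 1) * A ^ P.1)) := by rw [mul_pow, mul_pow]; ring
      _ ≤ C * ((1 / 2) ^ P.1 * (4 * A * (1 / 2) ^ P.2) +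
          (1 / 2) ^ P.2 * (4 * A * (1 / 2) ^ P.1)) := by
          gcongr C * (?_ ^ _ * ?_ + ?_ ^ _ * ?_)
          · linarith
          · exact natCast_mul_pow_le hA hy₂ e2 _
          · linarith
          · exact natCast_mul_pow_le hA hy₁ e1 _
      _ = _ := by ring

omit [NormedSpace ℂ E] in
theorem norm_block_le {a : Series₂ E} {C A : ℝ} (hA : 0 < A)
    (h : ∀ n m, ‖a n m‖ ≤ C * A ^ n * A ^ m) (p q n m j : ℕ) :
    ‖block p q a n m j‖ ≤ (C * A ^ (n * p) * A ^ (n * q)) * A ^ m * A ^ j := by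
  have hC : 0 ≤ C := (norm_nonneg _).trans (by simpa using h 0 0)
  unfold block
  split_ifs
  · refine (h _ _).trans_eq ?_
    rw [pow_add, pow_add]; ring
  · rw [norm_zero]; positivity

/-- The hooks of index at least `N` fill exactly the quadrant `i ≥ pN`, `j ≥ qN`, so the remainder
is `(x₁ᵖ x₂^q)^N` times a shifted series of the same type. -/
theorem norm_monomial_remainder_le {p q : ℕ} (hp : 0 < p) (hq : 0 < q) {a : Series₂ E} {C A : ℝ}
    (hA : 0 < A) (h : ∀ n m, ‖a n m‖ ≤ C * A ^ n * A ^ m) {x₁ x₂ : ℂ} (h1 : ‖x₁‖ * A ≤ 1 / 2)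
    (h2 : ‖x₂‖ * A ≤ 1 / 2) {v : E} {y : ℕ → E}
    (hv : HasSum (fun P : ℕ × ℕ => (x₁ ^ P.1 * x₂ ^ P.2) • a P.1 P.2) v)
    (hy : ∀ n, HasSum (fun P : ℕ × ℕ => (x₁ ^ P.1 * x₂ ^ P.2) • block p q a n P.1 P.2) (y n))
    (N : ℕ) : ‖v - ∑ n ∈ Finset.range N, (x₁ ^ p * x₂ ^ q) ^ n • y n‖
      ≤ 4 * C * (A ^ (p + q)) ^ N * ‖x₁ ^ p * x₂ ^ q‖ ^ N := by
  have hinj : Function.Injective fun P : ℕ × ℕ => (p * N + P.1, q * N + P.2) := by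
    rintro ⟨i, j⟩ ⟨i', j'⟩ h
    simpa using h
  have h3 := hv.sub (hasSum_hooks hp hq N hy)
  rw [← hinj.hasSum_iff] at h3
  · have h4 := summable_half_mul_half ((A ^ (p + q)) ^ N * ‖x₁ ^ p * x₂ ^ q‖ ^ N * C)
    refine (h3.norm_le_of_bounded h4 fun P => ?_).trans_eq (by ring)
    have h5 : ¬ min ((p * N + P.1) / p) ((q * N + P.2) / q) < N := by
      rw [Nat.mul_add_div hp, Nat.mul_add_div hq]
      generalize P.1 / p = u
      generalize P.2 / q = v
      omega
    simp only [Function.comp, h5, if_false, sub_zero]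
    have h6 := norm_term_two_le (b := fun n m => a (p * N + n) (q * N + m))
      (C := (A ^ (p + q)) ^ N * C) hA
      (fun n m => (h _ _).trans_eq (by rw [← pow_mul]; ring)) h1 h2 P
    calc ‖(x₁ ^ (p * N + P.1) * x₂ ^ (q * N + P.2)) • a (p * N + P.1) (q * N + P.2)‖
        = ‖x₁ ^ p * x₂ ^ q‖ ^ N *
          ‖(x₁ ^ P.1 * x₂ ^ P.2) • a (p * N + P.1) (q * N + P.2)‖ := by
          rw [← norm_pow, ← norm_smul, smul_smul]
          congr 2
          rw [pow_add, pow_add, mul_pow, pow_mul, pow_mul]; ring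
      _ ≤ ‖x₁ ^ p * x₂ ^ q‖ ^ N * ((A ^ (p + q)) ^ N * C * ((1 / 2) ^ P.1 * (1 / 2) ^ P.2)) := by
          gcongr
      _ = _ := by ring
  · rintro ⟨i, j⟩ hij
    dsimp only
    rw [if_pos, sub_self]
    by_contra hmin
    have e1 : p * N ≤ i := by
      rw [mul_comm]; exact (Nat.le_div_iff_mul_le hp).1 (by omega)
    have e2 : q * N ≤ j := by
      rw [mul_comm]; exact (Nat.le_div_iff_mul_le hq).1 (by omega)
    exact hij ⟨(i - p * N, j - q * N), by simp [Nat.add_sub_cancel' e1, Nat.add_sub_cancel' e2]⟩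

theorem mem_summableInMonomial_of_bound [CompleteSpace E] {p q : ℕ} (hp : 0 < p) (hq : 0 < q)
    {a : Series₂ E} {C A l : ℝ} (hl : 0 < l) (hA : 0 < A)
    (h : ∀ n m, ‖a n m‖ ≤ C * A ^ n * A ^ m) : a ∈ summableInMonomial E p q l := by
  have hC : 0 ≤ C := (norm_nonneg _).trans (by simpa using h 0 0)
  refine ⟨⟨1 / (2 * A), by positivity, fun j => ?_⟩, ∅, Set.finite_empty, fun d _ => ?_⟩
  · obtain ⟨c, hc, -⟩ := exists_isExpansionIn_of_bound (r := 1 / (2 * A)) (by positivity) hA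
      (by field_simp; rfl) h j
    exact ⟨c, hc⟩
  have hπl : 0 < Real.pi / l := div_pos Real.pi_pos hl
  set r₀ := 1 / (4 * A) with hr₀
  have hr₀0 : 0 < r₀ := by positivity
  have hr₀A : r₀ * A ≤ 1 / 4 := by rw [hr₀]; field_simp; rfl
  -- The sector constrains `‖x₁‖ᵖ` and `‖x₂‖^q`; the powers of `r₀` bring both variables back into
  -- `D_{r₀}`, and `r ≤ r₀` serves the polydisk.
  set r := min r₀ (min (r₀ ^ p) (r₀ ^ q)) with hr
  have hr0 : 0 < r := by positivity
  have hrA : r * A ≤ 1 / 4 := le_trans (by gcongr; exact min_le_left _ _) hr₀A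
  obtain ⟨hFd, -, hFs⟩ := hasBoundedSum_of_bound hA hr₀A h
  have hg := fun n => hasBoundedSum_of_bound hA hrA (norm_block_le hA h p q n)
  refine ⟨d - Real.pi / l, d + Real.pi / l, r, hr0, by linarith, by ring,
    fun z => ∑' P : ℕ × ℕ, (z.1 ^ P.1 * z.2.1 ^ P.2) • a P.1 P.2, fun ν => ?_, r, hr0, le_rfl,
    fun n x => ∑' P : ℕ × ℕ, (x.1 ^ P.1 * x.2 ^ P.2) • block p q a n P.1 P.2, hg,
    fun a' b' ρ _ _ _ _ _ => ⟨4 * C + 1, by positivity, A ^ (p + q), by positivity,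
      fun N z _ hz1 hz2 => ?_⟩⟩
  · refine hFd.comp (f := fun w : ℂ × ℂ => (Complex.exp w.1, Complex.exp w.2))
      (by fun_prop) fun w hw => ?_
    obtain ⟨-, -, e1, -, e2, -, -⟩ := hw
    constructor
    · rw [mem_ball_zero_iff]
      exact lt_of_pow_lt_pow_left₀ p hr₀0.le
        (e1.trans_le ((min_le_right _ _).trans (min_le_left _ _)))
    · rw [mem_ball_zero_iff]
      exact lt_of_pow_lt_pow_left₀ q hr₀0.le
        (e2.trans_le ((min_le_right _ _).trans (min_le_right _ _)))
  · have hmem : (z.1, z.2.1) ∈ Metric.ball (0 : ℂ) r ×ˢ Metric.ball (0 : ℂ) r :=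
      ⟨mem_ball_zero_iff.2 hz1, mem_ball_zero_iff.2 hz2⟩
    have hsub : Metric.ball (0 : ℂ) r ⊆ Metric.ball 0 r₀ :=
      Metric.ball_subset_ball (min_le_left _ _)
    have h1 := norm_monomial_remainder_le hp hq hA h (x₁ := z.1) (x₂ := z.2.1) (by nlinarith)
      (by nlinarith) (hFs (z.1, z.2.1) ⟨hsub hmem.1, hsub hmem.2⟩)
      (fun n => (hg n).2.2 (z.1, z.2.1) hmem) N
    refine h1.trans ?_
    calc 4 * C * (A ^ (p + q)) ^ N * ‖z.1 ^ p * z.2.1 ^ q‖ ^ N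
        = 4 * C * (A ^ (p + q)) ^ N * 1 * ‖z.1 ^ p * z.2.1 ^ q‖ ^ N := by ring
      _ ≤ _ := by
        gcongr
        · linarith
        · exact one_le_factorial_rpow N (by positivity)

end Convergent

end MonomialSummability

theorem mainTheorem3 {E : Type*} [NormedAddCommGroup E] [NormedSpace ℂ E] [CompleteSpace E]
    (p q : ℕ) (hp : 0 < p) (hq : 0 < q) (k l : ℝ) (hk : 0 < k) (hl : 0 < l) :
    ((∀ r r' : ℝ, 0 < r → 0 < r' →
        MonomialSummability.summableInVariable E 0 r k ∩
          MonomialSummability.summableInVariable E 1 r' l ⊆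
            MonomialSummability.convergentSeries E) ∧
      (∀ f ∈ MonomialSummability.convergentSeries E, ∃ r₀ > 0, ∀ r : ℝ, 0 < r → r ≤ r₀ →
        f ∈ MonomialSummability.summableInVariable E 0 r k ∩
          MonomialSummability.summableInVariable E 1 r l)) ∧
    (∀ j : Fin 2,
      (∀ r : ℝ, 0 < r →
        MonomialSummability.summableInVariable E j r k ∩
          MonomialSummability.summableInMonomial E p q l ⊆
            MonomialSummability.convergentSeries E) ∧
      (∀ f ∈ MonomialSummability.convergentSeries E, ∃ r₀ > 0, ∀ r : ℝ, 0 < r → r ≤ r₀ →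
        f ∈ MonomialSummability.summableInVariable E j r k ∩
          MonomialSummability.summableInMonomial E p q l)) := by
  have hvar : ∀ f ∈ MonomialSummability.convergentSeries E, ∃ r₀ > 0, ∀ r : ℝ, 0 < r → r ≤ r₀ →
      ∀ (j : Fin 2) (k : ℝ), 0 < k → f ∈ MonomialSummability.summableInVariable E j r k := by
    intro f hf
    obtain ⟨C, A, hA, h⟩ := MonomialSummability.exists_bound_of_mem_convergentSeries hf
    refine ⟨1 / (2 * A), by positivity, fun r hr hr₀ j k hk =>
      MonomialSummability.mem_summableInVariable_of_bound hk hr hA ?_ h j⟩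
    calc r * A ≤ 1 / (2 * A) * A := by gcongr
      _ = 1 / 2 := by field_simp
  refine ⟨⟨fun r r' hr hr' f hf =>
    MonomialSummability.convergent_of_summableInVariable hk hl hr hr' hf.1 hf.2, fun f hf => ?_⟩,
    fun j => ⟨fun r hr f hf => ?_, fun f hf => ?_⟩⟩
  · obtain ⟨r₀, hr₀, h⟩ := hvar f hf
    exact ⟨r₀, hr₀, fun r hr hrr₀ => ⟨h r hr hrr₀ 0 k hk, h r hr hrr₀ 1 l hl⟩⟩
  · fin_cases j
    · exact MonomialSummability.convergent_of_summableInMonomial hp hq hk hl hr hf.1 hf.2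
    · exact MonomialSummability.mem_convergentSeries_transpose
        (MonomialSummability.convergent_of_summableInMonomial hq hp hk hl hr
          (MonomialSummability.mem_summableInVariable_transpose.2 hf.1)
          (MonomialSummability.mem_summableInMonomial_transpose hf.2))
  · obtain ⟨r₀, hr₀, h⟩ := hvar f hf
    obtain ⟨C, A, hA, hb⟩ := MonomialSummability.exists_bound_of_mem_convergentSeries hf
    exact ⟨r₀, hr₀, fun r hr hrr₀ => ⟨h r hr hrr₀ j k hk,
      MonomialSummability.mem_summableInMonomial_of_bound hp hq hl hA hb⟩⟩
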